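/- Let $\alpha\in\mathbb R$ and let $M_1,M_2$ be two Maya diagrams, i.e. sets of integers containing only finitely many non-negative integers and omitting only finitely many negative ones. Let $n_1>\dots>n_{r_1}\ge 0$ and $m_1>\dots>m_{r_2}\ge0$ be the non-negative members of $M_1$ and $M_2$, and let $n'_1>\dots>n'_{r_4}\ge0$ and $m'_1>\dots>m'_{r_3}\ge0$ be the numbers $-k-1$ for the negative integers $k$ missing from $M_1$ and $M_2$. Put $r=r_1+r_2+r_3+r_4$, and let $f_1,\dots,f_r$ be the seed functions $$L_{n_j}^{\alpha}(x)\ (j\le r_1),\quad e^xL_{m_j}^{\alpha}(-x)\ (j\le r_2),\quad x^{-\alpha}L_{m'_j}^{-\alpha}(x)\ (j\le r_3),\quad e^xx^{-\alpha}L_{n'_j}^{-\alpha}(-x)\ (j\le r_4),$$ where $L_n^\alpha$ are the classical Laguerre polynomials; they are eigenfunctions of the classical Laguerre expression $\ell^\alpha[y]=-xy''+(x-\alpha-1)y'$. Let $$\Omega(x)=e^{-(r_2+r_4)x}\,x^{(\alpha+r_1+r_2)(r_3+r_4)}\,\mathrm{Wr}[f_1,\dots,f_r](x)\qquad(x>0),$$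 which is a polynomial in $x$, and assume that $\Omega$ has no zero on $[0,\infty)$. Let $\mathcal L$ be the exceptional Laguerre expression on $(0,\infty)$ obtained from $\ell^\alpha$ by the $r$ successive Darboux transformations with the seed functions $f_1,\dots,f_r$, in the gauge in which eigenfunctions $h$ of $\ell^\alpha$ are mapped to $e^{-(r_2+r_4)x}x^{(\alpha+r_1+r_2+1)(r_3+r_4)}\mathrm{Wr}[f_1,\dots,f_r,h]$. Explicitly, $\mathcal L=\sigma\,\widetilde{\mathcal L}\,\sigma^{-1}$ with $\sigma=x^{r_3+r_4}\Omega$ and $$\widetilde{\mathcal L}[y]=-xy''+(x-\alpha-1-r)y'+(r-u-2xu')y,\qquad u=\frac{\mathrm{Wr}[f_1,\dots,f_r]'}{\mathrm{Wr}[f_1,\dots,f_r]}.$$ Its weight function is $\mathcal W(x)=x^{\boldsymbol\alpha}e^{-x}/\Omega(x)^2$, with parameter $\boldsymbol\alpha=\alpha+r_1+r_2-r_3-r_4$. Call $\mathcal L$ limit-circle at an endpoint of $(0,\infty)$ if, for every $\lambda\in\mathbb C$, all solutions of $\mathcal L[y]=\lambda y$ on $(0,\infty)$ are square integrable with respect to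 $\mathcal W(x)\,dx$ near that endpoint, and limit-point there if, for every $\lambda\in\mathbb C$, some solution is not. Then: (0) For every $\lambda\in\mathbb C$, the point $x=0$ is a regular singular point (in the sense of Frobenius) of $(\mathcal L-\lambda)y=0$, and the indicial equation there is $s(s+\boldsymbol\alpha)=0$. (a) $\mathcal L$ is limit-circle at $x=0$ if $-1<\boldsymbol\alpha<1$, and limit-point at $x=0$ if $\boldsymbol\alpha\ge1$. (b) $\mathcal L$ is limit-point at $x=\infty$ if $\boldsymbol\alpha>0$. -/

import Mathlib

open Filter Topology Set MeasureTheory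

noncomputable section

/-! ### Second-order differential expressions on `(0, ∞)` and Darboux transformations -/

/-- The differential expression `y ↦ p y'' + q y' + r y` with real coefficient functions.
Only the values of `p, q, r` on `(0, ∞)` are used. -/
structure DiffExpr where
  p : ℝ → ℝ
  q : ℝ → ℝ
  r : ℝ → ℝ

namespace DiffExpr

/-- The action of the expression on a complex-valued function. -/
def apply (E : DiffExpr) (y : ℝ → ℂ) (x : ℝ) : ℂ :=
  (E.p x : ℂ) * deriv (deriv y) x + (E.q x : ℂ) * deriv y x + (E.r x : ℂ) * y x

/-- The partner expression in one Darboux transformation with `w = φ' / φ`, where `φ` is an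
eigenfunction of `E`: if `E = B ∘ A + lam₀` with `A y = y' - w y` and `B y = p y' + (p w + q) y`,
then the partner is `A ∘ B + lam₀`, whose coefficients are the ones given here. -/
def darboux (E : DiffExpr) (w : ℝ → ℝ) : DiffExpr where
  p := E.p
  q := fun x => E.q x + deriv E.p x
  r := fun x => E.r x + deriv E.q x + w x * deriv E.p x + 2 * deriv w x * E.p x

/-- The result of `n` successive Darboux transformations with logarithmic derivatives
`w₁, …, wₙ`, where `u = w₁ + ⋯ + wₙ`. If `fs` is the list of seed functions (eigenfunctions of
`E`), then `w₁ + ⋯ + wₙ` is the logarithmic derivative of their Wronskian. -/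
def iteratedDarboux (E : DiffExpr) (n : ℕ) (u : ℝ → ℝ) : DiffExpr where
  p := E.p
  q := fun x => E.q x + n * deriv E.p x
  r := fun x => E.r x + n * deriv E.q x + (n * (n - 1) / 2 : ℝ) * deriv (deriv E.p) x
    + u x * deriv E.p x + 2 * deriv u x * E.p x

/-- The gauge-equivalent expression `σ ∘ E ∘ σ⁻¹`. -/
def gauge (E : DiffExpr) (σ : ℝ → ℝ) : DiffExpr where
  p := E.p
  q := fun x => E.q x - 2 * E.p x * (deriv σ x / σ x)
  r := fun x => E.r x - E.q x * (deriv σ x / σ x)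
    + E.p x * (2 * (deriv σ x / σ x) ^ 2 - deriv (deriv σ) x / σ x)

/-- `iteratedDarboux` with `0` steps is the original expression. -/
theorem iteratedDarboux_zero (E : DiffExpr) : E.iteratedDarboux 0 (fun _ => 0) = E := by
  cases E
  simp [iteratedDarboux]

/-- `iteratedDarboux` with `n + 1` steps is one more Darboux transformation. -/
theorem iteratedDarboux_succ (E : DiffExpr) (n : ℕ) (u w : ℝ → ℝ)
    (hq : Differentiable ℝ E.q) (hp : Differentiable ℝ (deriv E.p)) (x : ℝ)
    (hu : DifferentiableAt ℝ u x) (hw : DifferentiableAt ℝ w x) :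
    ((E.iteratedDarboux n u).darboux w).p x = (E.iteratedDarboux (n + 1) (u + w)).p x ∧
    ((E.iteratedDarboux n u).darboux w).q x = (E.iteratedDarboux (n + 1) (u + w)).q x ∧
    ((E.iteratedDarboux n u).darboux w).r x = (E.iteratedDarboux (n + 1) (u + w)).r x := by
  have h1 : deriv (fun x => E.q x + n * deriv E.p x) x
      = deriv E.q x + n * deriv (deriv E.p) x := by
    rw [deriv_fun_add (hq x) ((hp x).const_mul _), deriv_const_mul_field]
  have h2 : deriv (u + w) x = deriv u x + deriv w x := deriv_add hu hw
  refine ⟨rfl, ?_, ?_⟩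
  · simp only [darboux, iteratedDarboux]
    push_cast
    ring
  · simp only [darboux, iteratedDarboux, h1, h2, Pi.add_apply]
    push_cast
    ring

/-- `y` is a (complex-valued, classical) solution of `E[y] = lam y` on `(0, ∞)`. -/
def IsSolution (E : DiffExpr) (lam : ℂ) (y : ℝ → ℂ) : Prop :=
  ∀ x, 0 < x → DifferentiableAt ℝ y x ∧ DifferentiableAt ℝ (deriv y) x ∧
    E.apply y x = lam * y x

/-- `E` is in the limit-circle case at `x = 0` (with respect to the weight `W`): for every
`lam ∈ ℂ`, all solutions of `E[y] = lam y` are square integrable near `0` with respect to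
`W(x) dx`. -/
def LimitCircleAtZero (E : DiffExpr) (W : ℝ → ℝ) : Prop :=
  ∀ lam : ℂ, ∀ y : ℝ → ℂ, E.IsSolution lam y →
    ∃ c, 0 < c ∧ IntegrableOn (fun x => ‖y x‖ ^ 2 * W x) (Ioo 0 c)

/-- `E` is in the limit-point case at `x = 0`: for every `lam ∈ ℂ`, some solution of
`E[y] = lam y` is not square integrable near `0` with respect to `W(x) dx`. -/
def LimitPointAtZero (E : DiffExpr) (W : ℝ → ℝ) : Prop :=
  ∀ lam : ℂ, ∃ y : ℝ → ℂ, E.IsSolution lam y ∧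
    ∀ c, 0 < c → ¬ IntegrableOn (fun x => ‖y x‖ ^ 2 * W x) (Ioo 0 c)

/-- `E` is in the limit-point case at `x = ∞`: for every `lam ∈ ℂ`, some solution of
`E[y] = lam y` is not square integrable near `∞` with respect to `W(x) dx`. -/
def LimitPointAtTop (E : DiffExpr) (W : ℝ → ℝ) : Prop :=
  ∀ lam : ℂ, ∃ y : ℝ → ℂ, E.IsSolution lam y ∧
    ∀ c, 0 < c → ¬ IntegrableOn (fun x => ‖y x‖ ^ 2 * W x) (Ioi c)

/-- The point `x = 0` is a regular singular point, in the sense of Frobenius, of the equation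
`E[y] = lam y`, with indicial polynomial `ind`: dividing by the leading coefficient, the equation
becomes `x² y'' + x b(x) y' + c(x) y = 0` for small `x > 0`, with `b` and `c` analytic at `0`, and
`ind s = s (s - 1) + b(0) s + c(0)`. -/
def HasIndicialPolynomialAtZero (E : DiffExpr) (lam : ℂ) (ind : ℂ → ℂ) : Prop :=
  ∃ (b : ℝ → ℝ) (c : ℝ → ℂ), AnalyticAt ℝ b 0 ∧ AnalyticAt ℝ c 0 ∧
    (∀ᶠ x in 𝓝[>] (0 : ℝ), E.p x ≠ 0 ∧ b x = x * E.q x / E.p x ∧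
      c x = (x : ℂ) ^ 2 * ((E.r x : ℂ) - lam) / (E.p x : ℂ)) ∧
    ∀ s : ℂ, ind s = s * (s - 1) + (b 0 : ℂ) * s + c 0

end DiffExpr

/-! ### Laguerre data -/

/-- The classical Laguerre polynomial
`L_n^α(x) = ∑_{k ≤ n} (-1)^k binom(n + α, n - k) x^k / k!`, for real `α`. -/
def laguerrePoly (n : ℕ) (α x : ℝ) : ℝ :=
  ∑ k ∈ Finset.range (n + 1),
    (-1) ^ k * (∏ i ∈ Finset.Ioc k n, (α + i)) / ((n - k).factorial * k.factorial) * x ^ k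

/-- The classical Laguerre differential expression `ℓ^α[y] = -x y'' + (x - α - 1) y'`. -/
def laguerreExpr (α : ℝ) : DiffExpr where
  p := fun x => -x
  q := fun x => x - α - 1
  r := fun _ => 0

/-- A Maya diagram: a set of integers that contains only finitely many non-negative integers and
omits only finitely many negative ones. -/
structure MayaDiagram where
  carrier : Set ℤ
  finite_right : {n : ℕ | (n : ℤ) ∈ carrier}.Finite
  finite_left : {n : ℕ | -(n : ℤ) - 1 ∉ carrier}.Finite

namespace MayaDiagram

/-- The non-negative members `n₁ > n₂ > ⋯ ≥ 0` of the diagram. -/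
def right (M : MayaDiagram) : List ℕ := M.finite_right.toFinset.sort (· ≥ ·)

/-- The labels `n' = -k - 1` of the negative integers `k` missing from the diagram,
`n₁' > n₂' > ⋯ ≥ 0`. -/
def left (M : MayaDiagram) : List ℕ := M.finite_left.toFinset.sort (· ≥ ·)

end MayaDiagram

/-- The seed functions, all of them eigenfunctions of `ℓ^α`, selected by
`M₁ = (n₁', …, n_{r₄}' | n₁, …, n_{r₁})` and `M₂ = (m₁', …, m_{r₃}' | m₁, …, m_{r₂})`:
`L_{n_j}^α(x)`, `e^x L_{m_j}^α(-x)`, `x^{-α} L_{m_j'}^{-α}(x)`, `e^x x^{-α} L_{n_j'}^{-α}(-x)`. -/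
def seeds (α : ℝ) (M₁ M₂ : MayaDiagram) : List (ℝ → ℝ) :=
  M₁.right.map (fun n x => laguerrePoly n α x) ++
  M₂.right.map (fun m x => Real.exp x * laguerrePoly m α (-x)) ++
  M₂.left.map (fun m x => x ^ (-α) * laguerrePoly m (-α) x) ++
  M₁.left.map (fun n x => Real.exp x * x ^ (-α) * laguerrePoly n (-α) (-x))

/-- The Wronskian of a list of functions (equal to `1` for the empty list). -/
def wronskianList (fs : List (ℝ → ℝ)) (x : ℝ) : ℝ :=
  (Matrix.of fun i j : Fin fs.length => iteratedDeriv i (fs.get j) x).det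

/-- The generalized Laguerre polynomial
`Ω(x) = e^{-(r₂ + r₄) x} x^{(α + r₁ + r₂)(r₃ + r₄)} Wr[f₁, …, f_r](x)`, for `x > 0`. -/
def genLaguerre (α : ℝ) (M₁ M₂ : MayaDiagram) (x : ℝ) : ℝ :=
  Real.exp (-((M₂.right.length + M₁.left.length : ℝ) * x)) *
  x ^ ((α + M₁.right.length + M₂.right.length) * (M₂.left.length + M₁.left.length : ℝ)) *
  wronskianList (seeds α M₁ M₂) x

/-- Admissibility: the generalized Laguerre polynomial has no zero on `[0, ∞)`. Its value at `0`
is expressed as the limit from the right, since the formula for `Ω` is valid for `x > 0` only. -/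
def Admissible (α : ℝ) (M₁ M₂ : MayaDiagram) : Prop :=
  (∀ x, 0 < x → genLaguerre α M₁ M₂ x ≠ 0) ∧
  ∃ c : ℝ, c ≠ 0 ∧ Tendsto (genLaguerre α M₁ M₂) (𝓝[>] 0) (𝓝 c)

/-- The parameter of the exceptional expression: the exponent `α + r₁ + r₂ - r₃ - r₄` of `x` in its
weight function. -/
def xopParam (α : ℝ) (M₁ M₂ : MayaDiagram) : ℝ :=
  α + M₁.right.length + M₂.right.length - M₂.left.length - M₁.left.length

/-- The exceptional Laguerre expression: the Darboux transformation of `ℓ^α` by all the seed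
functions, in the gauge `σ = x^{r₃ + r₄} Ω` in which its eigenfunctions are
`Ω[h] = e^{-(r₂ + r₄) x} x^{(α + r₁ + r₂ + 1)(r₃ + r₄)} Wr[f₁, …, f_r, h]`, for `h` an
eigenfunction of `ℓ^α`. -/
def xopExpr (α : ℝ) (M₁ M₂ : MayaDiagram) : DiffExpr :=
  ((laguerreExpr α).iteratedDarboux (seeds α M₁ M₂).length
      (logDeriv (wronskianList (seeds α M₁ M₂)))).gauge
    (fun x => x ^ (M₂.left.length + M₁.left.length) * genLaguerre α M₁ M₂ x)

/-- The weight function of the exceptional expression: `x^a e^{-x} / Ω(x)²`, where `a` is the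
parameter of the expression. -/
def xopWeight (α : ℝ) (M₁ M₂ : MayaDiagram) (x : ℝ) : ℝ :=
  x ^ xopParam α M₁ M₂ * Real.exp (-x) / genLaguerre α M₁ M₂ x ^ 2

end

/-! On `(0, ∞)` the expression is explicit in the polynomial `P` that represents `Ω`: the leading
coefficient is `-x`, the first-order one is `x g - a - 1` with `g = 1 + 2 P'/P` and `a` the
parameter, and the zeroth-order one, `r`, is rational with denominator `P`. Since `P` has no zero on
`[0, ∞)`, `g` and `r` are analytic at `0`, which gives the indicial equation; since `x P'/P`, `(x -
a) P'/P` and `x P''/P` are bounded on `[1, ∞)`, the behaviour at infinity is that of `-x y'' + x y'`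
up to bounded coefficients (`xopExpr_coeff`).

The endpoint classification uses no Frobenius series, so resonant integer exponents need no separate
treatment. Near `0` the pair `(y, x y')` solves an Euler system with exponents `0` and `-a` plus an
integrable perturbation. A weighted energy bounds every solution by nearly the larger of these
powers, which settles limit-circle (`limitCircleAtZero_of_bounded`). For limit-point a single large
solution is enough: initial data are chosen on the growing direction, and a cone argument
(`dominant_component_growth`) keeps the solution there. Its size is about `x^{-a}` at `0` and `e^x`,
up to powers of `x`, at infinity; both defeat the weight. -/

/-! ### Functions `e^{c x} x^β Q(x) / x^N` and the Wronskian of the seeds -/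

open Polynomial in
/-- On `(0, ∞)`, `f` has the form `e^{c x} x^β Q(x) / x^N` with a polynomial `Q`. -/
def IsExpRpowLaurent (c β : ℝ) (f : ℝ → ℝ) : Prop :=
  ∃ (N : ℕ) (Q : ℝ[X]), ∀ x, 0 < x → f x = Real.exp (c * x) * x ^ β * (Q.eval x / x ^ N)

namespace IsExpRpowLaurent

open Polynomial

variable {c β c' β' : ℝ} {f g : ℝ → ℝ}

theorem add (hf : IsExpRpowLaurent c β f) (hg : IsExpRpowLaurent c β g) :
    IsExpRpowLaurent c β (fun x => f x + g x) := by
  obtain ⟨N, Q, hf⟩ := hf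
  obtain ⟨K, R, hg⟩ := hg
  refine ⟨N + K, Q * X ^ K + R * X ^ N, fun x hx => ?_⟩
  simp only [hf x hx, hg x hx, eval_add, eval_mul, eval_pow, eval_X]
  field_simp
  ring

theorem const_mul (a : ℝ) (hf : IsExpRpowLaurent c β f) :
    IsExpRpowLaurent c β (fun x => a * f x) := by
  obtain ⟨N, Q, hf⟩ := hf
  refine ⟨N, C a * Q, fun x hx => ?_⟩
  simp only [hf x hx, eval_mul, eval_C]
  ring

theorem mul (hf : IsExpRpowLaurent c β f) (hg : IsExpRpowLaurent c' β' g) :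
    IsExpRpowLaurent (c + c') (β + β') (fun x => f x * g x) := by
  obtain ⟨N, Q, hf⟩ := hf
  obtain ⟨K, R, hg⟩ := hg
  refine ⟨N + K, Q * R, fun x hx => ?_⟩
  simp only [hf x hx, hg x hx]
  rw [add_mul, Real.exp_add, Real.rpow_add hx, eval_mul, pow_add,
    mul_div_mul_comm]
  ring

theorem zero : IsExpRpowLaurent c β (fun _ => 0) := ⟨0, 0, fun x _ => by simp⟩

theorem one : IsExpRpowLaurent 0 0 (fun _ => 1) := ⟨0, 1, fun x _ => by simp⟩

theorem sum {ι : Type*} (s : Finset ι) {F : ι → ℝ → ℝ}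
    (h : ∀ i ∈ s, IsExpRpowLaurent c β (F i)) :
    IsExpRpowLaurent c β (fun x => ∑ i ∈ s, F i x) := by
  classical
  induction s using Finset.induction_on with
  | empty => simpa using zero
  | insert i s hi ih =>
    simp only [Finset.sum_insert hi]
    exact (h i (by simp)).add (ih fun j hj => h j (by simp [hj]))

theorem prod {ι : Type*} (s : Finset ι) {F : ι → ℝ → ℝ} {c β : ι → ℝ}
    (h : ∀ i ∈ s, IsExpRpowLaurent (c i) (β i) (F i)) :
    IsExpRpowLaurent (∑ i ∈ s, c i) (∑ i ∈ s, β i) (fun x => ∏ i ∈ s, F i x) := by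
  classical
  induction s using Finset.induction_on with
  | empty => simpa using one
  | insert i s hi ih =>
    simp only [Finset.sum_insert hi, Finset.prod_insert hi]
    exact (h i (by simp)).mul (ih fun j hj => h j (by simp [hj]))

theorem deriv (hf : IsExpRpowLaurent c β f) : IsExpRpowLaurent c β (deriv f) := by
  obtain ⟨N, Q, hf⟩ := hf
  -- The function is `e^{c x} x^{β - N} Q`; its three product-rule terms are brought over one extra
  -- power of `x`.
  refine ⟨N + 1, C c * X * Q + C (β - N) * Q + X * derivative Q, fun x hx => ?_⟩
  have hne : x ^ N ≠ 0 := by positivity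
  have h1 : HasDerivAt (fun x : ℝ => Real.exp (c * x)) (Real.exp (c * x) * c) x := by
    simpa using ((hasDerivAt_id x).const_mul c).exp
  have h2 : HasDerivAt (fun x : ℝ => x ^ β) (β * x ^ (β - 1)) x :=
    Real.hasDerivAt_rpow_const (Or.inl hx.ne')
  have h3 := (Q.hasDerivAt x).div (hasDerivAt_pow N x) hne
  have h4 := (h1.mul h2).mul h3
  have h5 : HasDerivAt f _ x :=
    h4.congr_of_eventuallyEq (by filter_upwards [lt_mem_nhds hx] with y hy using hf y hy)
  rw [h5.deriv]
  have h6 : x ^ (β - 1) = x ^ β / x := by rw [Real.rpow_sub_one hx.ne']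
  have h7 : (N : ℝ) * x ^ (N - 1) = N * x ^ N / x := by
    cases N with
    | zero => simp
    | succ n => field_simp; simp [pow_succ]
  simp only [Pi.mul_apply, Pi.div_apply, h6, h7, eval_add, eval_mul, eval_C, eval_X, pow_succ]
  field_simp
  ring

theorem iteratedDeriv (hf : IsExpRpowLaurent c β f) (i : ℕ) :
    IsExpRpowLaurent c β (iteratedDeriv i f) := by
  induction i with
  | zero => simpa using hf
  | succ i ih => rw [iteratedDeriv_succ]; exact ih.deriv

end IsExpRpowLaurent

theorem sum_fin_cast_get {ι : Type*} (l : List ι) (g : ι → ℝ) (n : ℕ) (h : n = l.length) :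
    ∑ j : Fin n, g (l.get (j.cast h)) = (l.map g).sum := by
  subst h
  simp [Fin.sum_univ_fun_getElem]

/-- Every term of the Leibniz expansion takes exactly one derivative of each function, and
derivatives keep both exponents. All terms therefore share the same total exponents and may be
added. -/
theorem isExpRpowLaurent_wronskianList {cs : List (ℝ × ℝ)} {fs : List (ℝ → ℝ)}
    (h : List.Forall₂ (fun p f => IsExpRpowLaurent p.1 p.2 f) cs fs) :
    IsExpRpowLaurent (cs.map Prod.fst).sum (cs.map Prod.snd).sum (wronskianList fs) := by
  have hl : fs.length = cs.length := h.length_eq.symm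
  have hW : wronskianList fs = fun x => ∑ σ : Equiv.Perm (Fin fs.length),
      ((Equiv.Perm.sign σ : ℤ) : ℝ) * ∏ j, iteratedDeriv (σ j) (fs.get j) x := by
    funext x
    rw [wronskianList, Matrix.det_apply']
    rfl
  rw [hW, ← sum_fin_cast_get cs Prod.fst _ hl, ← sum_fin_cast_get cs Prod.snd _ hl]
  refine .sum _ fun σ _ => .const_mul _ (.prod _ fun j _ => ?_)
  refine IsExpRpowLaurent.iteratedDeriv ?_ _
  exact h.get (by have := j.2; omega) j.2

/-- The Laguerre polynomial as an element of `ℝ[X]`. -/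
theorem exists_eval_eq_laguerrePoly (n : ℕ) (α : ℝ) :
    ∃ Q : Polynomial ℝ, ∀ x, Q.eval x = laguerrePoly n α x :=
  ⟨∑ k ∈ Finset.range (n + 1), Polynomial.C ((-1) ^ k * (∏ i ∈ Finset.Ioc k n, (α + i)) /
    ((n - k).factorial * k.factorial)) * Polynomial.X ^ k, fun x => by
    simp [laguerrePoly, Polynomial.eval_finsetSum]⟩

theorem isExpRpowLaurent_laguerre (n : ℕ) (α c β ε : ℝ) :
    IsExpRpowLaurent c β (fun x => Real.exp (c * x) * x ^ β * laguerrePoly n α (ε * x)) := by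
  obtain ⟨Q, hQ⟩ := exists_eval_eq_laguerrePoly n α
  exact ⟨0, Q.comp (Polynomial.C ε * Polynomial.X), fun x _ => by simp [hQ]⟩

theorem forall₂_replicate_map {ι : Type*} (c β : ℝ) (l : List ι) (F : ι → ℝ → ℝ)
    (h : ∀ i, IsExpRpowLaurent c β (F i)) :
    List.Forall₂ (fun p f => IsExpRpowLaurent p.1 p.2 f)
      (List.replicate l.length (c, β)) (l.map F) := by
  induction l with
  | nil => simp
  | cons a l ih => exact .cons (h a) ih

theorem wronskianList_seeds (α : ℝ) (M₁ M₂ : MayaDiagram) :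
    IsExpRpowLaurent (M₂.right.length + M₁.left.length)
      (-α * (M₂.left.length + M₁.left.length)) (wronskianList (seeds α M₁ M₂)) := by
  have h : List.Forall₂ (fun p f => IsExpRpowLaurent p.1 p.2 f)
      (List.replicate M₁.right.length (0, 0) ++ List.replicate M₂.right.length (1, 0) ++
        List.replicate M₂.left.length (0, -α) ++ List.replicate M₁.left.length (1, -α))
      (seeds α M₁ M₂) := by
    refine List.rel_append (List.rel_append (List.rel_append ?_ ?_) ?_) ?_ <;>
      refine forall₂_replicate_map _ _ _ _ fun n => ?_
    · simpa using isExpRpowLaurent_laguerre n α 0 0 1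
    · simpa using isExpRpowLaurent_laguerre n α 1 0 (-1)
    · simpa using isExpRpowLaurent_laguerre n (-α) 0 (-α) 1
    · simpa using isExpRpowLaurent_laguerre n (-α) 1 (-α) (-1)
  have := isExpRpowLaurent_wronskianList h
  simp only [List.map_append, List.map_replicate, List.sum_append, List.sum_replicate,
    smul_zero, zero_add, add_zero, nsmul_eq_mul, mul_one] at this
  convert this using 1
  ring

/-! ### Polynomiality of `Ω` -/

/-- A function `Q(x) / x^N` on `(0, ∞)` with a nonzero limit at `0` is a polynomial there. -/
theorem exists_polynomial_of_laurent {F : ℝ → ℝ} {N : ℕ} {Q : Polynomial ℝ}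
    (hF : ∀ x, 0 < x → F x = Q.eval x / x ^ N) {c : ℝ} (hc : c ≠ 0)
    (hlim : Tendsto F (𝓝[>] 0) (𝓝 c)) :
    ∃ P : Polynomial ℝ, P.eval 0 ≠ 0 ∧ ∀ x, 0 < x → F x = P.eval x := by
  have hpos : ∀ᶠ x : ℝ in 𝓝[>] 0, 0 < x := eventually_mem_nhdsWithin
  have hQ : Q ≠ 0 := by
    rintro rfl
    refine hc (tendsto_nhds_unique hlim (tendsto_const_nhds.congr' ?_))
    filter_upwards [hpos] with x hx
    simp [hF x hx]
  obtain ⟨P, hP, hdvd⟩ := Polynomial.exists_eq_pow_rootMultiplicity_mul_and_not_dvd Q hQ 0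
  generalize Polynomial.rootMultiplicity 0 Q = v at hP
  have hP0 : P.eval 0 ≠ 0 := fun h => hdvd (Polynomial.dvd_iff_isRoot.2 h)
  have hPlim : Tendsto (fun x => P.eval x) (𝓝[>] 0) (𝓝 (P.eval 0)) :=
    (P.continuous.tendsto 0).mono_left nhdsWithin_le_nhds
  have hpow : ∀ k : ℕ, Tendsto (fun x : ℝ => x ^ (k + 1)) (𝓝[>] 0) (𝓝 0) := fun k => by
    have := ((continuous_pow (k + 1)).tendsto (0 : ℝ)).mono_left
      (nhdsWithin_le_nhds (s := Ioi (0 : ℝ)))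
    simpa using this
  have hF' : ∀ x, 0 < x → F x = x ^ v * P.eval x / x ^ N := fun x hx => by
    rw [hF x hx, hP]; simp
  -- With `F = x^{v - N} P` and `P(0) ≠ 0`: for `v < N` finiteness of the limit would force `P(0) =
  -- 0`, and for `v > N` the limit of `F` would be `0`.
  rcases lt_trichotomy v N with h | h | h
  · obtain ⟨k, rfl⟩ := Nat.exists_eq_add_of_lt h
    refine absurd (tendsto_nhds_unique hPlim ?_) hP0
    have := (hpow k).mul hlim
    rw [zero_mul] at this
    refine this.congr' ?_
    filter_upwards [hpos] with x hx
    rw [hF' x hx]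
    field_simp
    ring
  · refine ⟨P, hP0, fun x hx => ?_⟩
    rw [hF' x hx, h]
    field_simp
  · obtain ⟨k, rfl⟩ := Nat.exists_eq_add_of_lt h
    refine absurd (tendsto_nhds_unique hlim ?_) hc
    have := (hpow k).mul hPlim
    rw [zero_mul] at this
    refine this.congr' ?_
    filter_upwards [hpos] with x hx
    rw [hF' x hx]
    field_simp
    ring

/-- For an admissible pair of Maya diagrams, the generalized Laguerre polynomial is indeed a
polynomial, without zeros on `[0, ∞)`. -/
theorem Admissible.exists_polynomial {α : ℝ} {M₁ M₂ : MayaDiagram} (hM : Admissible α M₁ M₂) :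
    ∃ P : Polynomial ℝ, (∀ x, 0 ≤ x → P.eval x ≠ 0) ∧
      (∀ x, 0 < x → genLaguerre α M₁ M₂ x = P.eval x) ∧
      ∀ x, 0 < x → wronskianList (seeds α M₁ M₂) x =
        Real.exp ((M₂.right.length + M₁.left.length) * x) *
        x ^ (-((α + M₁.right.length + M₂.right.length) *
          (M₂.left.length + M₁.left.length : ℝ))) * P.eval x := by
  obtain ⟨hne, c, hc, hlim⟩ := hM
  obtain ⟨N, Q, hW⟩ := wronskianList_seeds α M₁ M₂
  have hG : ∀ x, 0 < x → genLaguerre α M₁ M₂ x =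
      (Q * Polynomial.X ^ ((M₁.right.length + M₂.right.length) *
        (M₂.left.length + M₁.left.length))).eval x / x ^ N := fun x hx => by
    -- The real power in the prefactor cancels the `x^{-α}` of the seeds, leaving a natural
    -- exponent.
    have h1 : x ^ ((α + M₁.right.length + M₂.right.length) *
        (M₂.left.length + M₁.left.length : ℝ)) *
        x ^ (-α * (M₂.left.length + M₁.left.length : ℝ)) =
        x ^ ((M₁.right.length + M₂.right.length) * (M₂.left.length + M₁.left.length)) := by
      rw [← Real.rpow_add hx, ← Real.rpow_natCast]
      congr 1
      push_cast
      ring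
    simp only [genLaguerre, hW x hx, Polynomial.eval_mul, Polynomial.eval_pow,
      Polynomial.eval_X, ← h1, Real.exp_neg]
    field_simp
  obtain ⟨P, hP0, hP⟩ := exists_polynomial_of_laurent hG hc hlim
  refine ⟨P, fun x hx => ?_, hP, fun x hx => ?_⟩
  · rcases hx.eq_or_lt with rfl | hx
    · exact hP0
    · exact hP x hx ▸ hne x hx
  · rw [← hP x hx, genLaguerre, Real.rpow_neg hx.le, Real.exp_neg]
    have := (Real.rpow_pos_of_pos hx ((α + M₁.right.length + M₂.right.length) *
        (M₂.left.length + M₁.left.length : ℝ))).ne'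
    field_simp

/-! ### Coefficients of the exceptional expression -/

theorem deriv_eq_of_eqOn_Ioi {E : Type*} [NormedAddCommGroup E] [NormedSpace ℝ E] {f g : ℝ → E}
    {g' : E} {x : ℝ} (hx : 0 < x)
    (h : ∀ y, 0 < y → f y = g y) (hg : HasDerivAt g g' x) : deriv f x = g' :=
  (hg.congr_of_eventuallyEq (by filter_upwards [lt_mem_nhds hx] with y hy using h y hy)).deriv

/-- The coefficients of the exceptional Laguerre expression in terms of the polynomial `Ω`. -/
theorem xopExpr_coeff {α : ℝ} {M₁ M₂ : MayaDiagram} {P : Polynomial ℝ}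
    (hP : ∀ x, 0 ≤ x → P.eval x ≠ 0)
    (hG : ∀ x, 0 < x → genLaguerre α M₁ M₂ x = P.eval x)
    (hW : ∀ x, 0 < x → wronskianList (seeds α M₁ M₂) x =
        Real.exp ((M₂.right.length + M₁.left.length) * x) *
        x ^ (-((α + M₁.right.length + M₂.right.length) *
          (M₂.left.length + M₁.left.length : ℝ))) * P.eval x) {x : ℝ} (hx : 0 < x) :
    (xopExpr α M₁ M₂).p x = -x ∧
    (xopExpr α M₁ M₂).q x = x - xopParam α M₁ M₂ - 1 +
      2 * x * (P.derivative.eval x / P.eval x) ∧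
    (xopExpr α M₁ M₂).r x = ((M₁.right.length : ℝ) - M₁.left.length) -
      (x - xopParam α M₁ M₂) * (P.derivative.eval x / P.eval x) -
      x * P.derivative.derivative.eval x / P.eval x := by
  have hlen : ((seeds α M₁ M₂).length : ℝ) = M₁.right.length + M₂.right.length +
      M₂.left.length + M₁.left.length := by
    simp [seeds]; ring
  obtain ⟨k, hk⟩ : ∃ k : ℕ, k = M₂.left.length + M₁.left.length := ⟨_, rfl⟩
  have hk' : (M₂.left.length + M₁.left.length : ℝ) = k := by rw [hk]; push_cast; ring
  obtain ⟨m, hm⟩ : ∃ m : ℝ, m = M₂.right.length + M₁.left.length := ⟨_, rfl⟩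
  obtain ⟨A, hA⟩ : ∃ A : ℝ, A = (α + M₁.right.length + M₂.right.length) * k := ⟨_, rfl⟩
  have hη : ∀ y, 0 < y → HasDerivAt (fun y => P.derivative.eval y / P.eval y)
      ((P.derivative.derivative.eval y * P.eval y - P.derivative.eval y * P.derivative.eval y) /
        P.eval y ^ 2) y := fun y hy => (P.derivative.hasDerivAt y).div (P.hasDerivAt y) (hP y hy.le)
  -- the logarithmic derivative of the Wronskian
  have hu : ∀ y, 0 < y → logDeriv (wronskianList (seeds α M₁ M₂)) y =
      m - A / y + P.derivative.eval y / P.eval y := fun y hy => by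
    have h1 : HasDerivAt (fun y : ℝ => Real.exp (m * y)) (Real.exp (m * y) * m) y := by
      simpa using ((hasDerivAt_id y).const_mul m).exp
    have h2 : HasDerivAt (fun y : ℝ => y ^ (-A)) (-A * y ^ (-A - 1)) y :=
      Real.hasDerivAt_rpow_const (Or.inl hy.ne')
    have h3 := (h1.mul h2).mul (P.hasDerivAt y)
    rw [hk', ← hm, ← hA] at hW
    have hpy := hP y hy.le
    have := (Real.rpow_pos_of_pos hy (-A)).ne'
    rw [logDeriv_apply, deriv_eq_of_eqOn_Ioi hy hW h3, hW y hy, Real.rpow_sub_one hy.ne']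
    simp only [Pi.mul_apply]
    field_simp
    ring
  have hu' : deriv (logDeriv (wronskianList (seeds α M₁ M₂))) x = A / x ^ 2 +
      (P.derivative.derivative.eval x * P.eval x - P.derivative.eval x * P.derivative.eval x) /
        P.eval x ^ 2 := by
    refine deriv_eq_of_eqOn_Ioi hx hu ?_
    convert! (((hasDerivAt_id x).inv hx.ne').const_mul (-A)).const_add m |>.add (hη x hx) using 1
    · funext y; simp; ring
    · simp; ring
  -- the gauge factor
  have hσ : ∀ y, 0 < y → y ^ k * genLaguerre α M₁ M₂ y = y ^ k * P.eval y := fun y hy => by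
    rw [hG y hy]
  have hσd : ∀ y, 0 < y → HasDerivAt (fun y => y ^ k * P.eval y)
      (y ^ k * P.eval y * (k / y + P.derivative.eval y / P.eval y)) y := fun y hy => by
    have hpy := hP y hy.le
    convert! (hasDerivAt_pow k y).mul (P.hasDerivAt y) using 1
    rcases k with _ | k
    · simp; field_simp
    · simp only [Nat.add_sub_cancel, pow_succ]; field_simp
  have hσ' : ∀ y, 0 < y → deriv (fun y => y ^ k * genLaguerre α M₁ M₂ y) y =
      y ^ k * P.eval y * (k / y + P.derivative.eval y / P.eval y) := fun y hy =>
    deriv_eq_of_eqOn_Ioi hy hσ (hσd y hy)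
  have hs : HasDerivAt (fun y => k / y + P.derivative.eval y / P.eval y) (-k / x ^ 2 +
      (P.derivative.derivative.eval x * P.eval x - P.derivative.eval x * P.derivative.eval x) /
        P.eval x ^ 2) x := by
    convert! ((hasDerivAt_id x).inv hx.ne').const_mul (k : ℝ) |>.add (hη x hx) using 1
    simp; ring
  have hσ'' := deriv_eq_of_eqOn_Ioi hx hσ' ((hσd x hx).mul hs)
  have hp1 : deriv (laguerreExpr α).p = fun _ => -1 := by
    funext y; simp [laguerreExpr]
  have hq1 : deriv (laguerreExpr α).q x = 1 := by
    simp only [laguerreExpr]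
    exact (((hasDerivAt_id x).sub_const α).sub_const 1).deriv
  have hpx := hP x hx.le
  have hxk : x ^ k ≠ 0 := by positivity
  have hσdiv : deriv (fun y => y ^ k * genLaguerre α M₁ M₂ y) x /
      (x ^ k * genLaguerre α M₁ M₂ x) = k / x + P.derivative.eval x / P.eval x := by
    rw [hσ' x hx, hσ x hx]; field_simp
  -- This is `σ''/σ = (σ'/σ)² + (σ'/σ)'`.
  have hσdiv2 : deriv (deriv fun y => y ^ k * genLaguerre α M₁ M₂ y) x /
      (x ^ k * genLaguerre α M₁ M₂ x) = (k / x + P.derivative.eval x / P.eval x) ^ 2 + (-k / x ^ 2 +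
      (P.derivative.derivative.eval x * P.eval x - P.derivative.eval x * P.derivative.eval x) /
        P.eval x ^ 2) := by
    rw [hσ'', hσ x hx]; field_simp
  have hpar : xopParam α M₁ M₂ = α + M₁.right.length + M₂.right.length - k := by
    rw [xopParam, ← hk']; ring
  have hr : ((seeds α M₁ M₂).length : ℝ) = M₁.right.length + M₂.right.length + k := by
    rw [hlen, ← hk']; ring
  have hκ : (M₁.right.length : ℝ) - M₁.left.length = M₁.right.length + M₂.right.length - m := by
    rw [hm]; ring
  refine ⟨rfl, ?_, ?_⟩
  · simp only [xopExpr, DiffExpr.gauge, DiffExpr.iteratedDarboux, ← hk, hσdiv, hp1, hr, hpar]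
    simp only [laguerreExpr]
    field_simp
    ring
  -- The `1/x` terms from the Wronskian and from the gauge cancel exactly because `A = (α + r₁ + r₂)
  -- k`.
  · simp only [xopExpr, DiffExpr.gauge, DiffExpr.iteratedDarboux, ← hk, hσdiv, hσdiv2, hp1, hr,
      hpar, hu x hx, hu', hq1, hκ, deriv_const']
    simp only [laguerreExpr, hA]
    field_simp
    ring

/-! ### Global solvability of linear equations -/

section LinearODE

variable {E : Type*} [NormedAddCommGroup E] [NormedSpace ℝ E]

/-- The terms of the Picard series for `v' = A v`, `v(t₀) = v₀`. -/
noncomputable def picardTerm (A : ℝ → E →L[ℝ] E) (t₀ : ℝ) (v₀ : E) : ℕ → ℝ → E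
  | 0 => fun _ => v₀
  | n + 1 => fun t => ∫ s in t₀..t, A s (picardTerm A t₀ v₀ n s)

variable {A : ℝ → E →L[ℝ] E}

theorem continuous_picardTerm (hA : Continuous A) (t₀ : ℝ) (v₀ : E) (n : ℕ) :
    Continuous (picardTerm A t₀ v₀ n) := by
  induction n with
  | zero => exact continuous_const
  | succ n ih =>
    exact intervalIntegral.continuous_primitive (μ := volume)
      (fun a b => (hA.clm_apply ih).intervalIntegrable a b) t₀

theorem hasDerivAt_picardTerm_succ [CompleteSpace E] (hA : Continuous A) (t₀ : ℝ) (v₀ : E) (n : ℕ) (t : ℝ) :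
    HasDerivAt (picardTerm A t₀ v₀ (n + 1)) (A t (picardTerm A t₀ v₀ n t)) t :=
  (hA.clm_apply (continuous_picardTerm hA t₀ v₀ n)).integral_hasStrictDerivAt t₀ t |>.hasDerivAt

/-- The bound is the `n`-th Taylor term of `‖v₀‖ e^{K |t - t₀|}`. It is the summable majorant needed
to differentiate the Picard series term by term. -/
theorem norm_picardTerm_le {t₀ T K : ℝ} (hK : ∀ t ∈ Icc (t₀ - T) (t₀ + T), ‖A t‖ ≤ K)
    (hK0 : 0 ≤ K) (v₀ : E) (n : ℕ) :
    ∀ t ∈ Icc (t₀ - T) (t₀ + T),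
      ‖picardTerm A t₀ v₀ n t‖ ≤ ‖v₀‖ * (K * |t - t₀|) ^ n / n.factorial := by
  induction n with
  | zero => intro t _; simp [picardTerm]
  | succ n ih =>
    intro t ht
    have hT : 0 ≤ T := by have := ht.1.trans ht.2; linarith
    have hsub : uIcc t₀ t ⊆ Icc (t₀ - T) (t₀ + T) :=
      uIcc_subset_Icc ⟨by linarith, by linarith⟩ ht
    have hbound : ∀ s ∈ uIoc t₀ t, ‖A s (picardTerm A t₀ v₀ n s)‖ ≤
        ‖v₀‖ * K ^ (n + 1) / n.factorial * |s - t₀| ^ n := fun s hs => by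
      have hs' := hsub (uIoc_subset_uIcc hs)
      calc ‖A s (picardTerm A t₀ v₀ n s)‖
          ≤ K * (‖v₀‖ * (K * |s - t₀|) ^ n / n.factorial) :=
            ((A s).le_opNorm _).trans (mul_le_mul (hK s hs') (ih s hs') (norm_nonneg _) hK0)
        _ = _ := by rw [mul_pow]; ring
    have hint : ∀ a b : ℝ, IntervalIntegrable
        (fun s => ‖v₀‖ * K ^ (n + 1) / n.factorial * |s - t₀| ^ n) volume a b := fun a b =>
      Continuous.intervalIntegrable (by fun_prop) a b
    have h1 : ‖picardTerm A t₀ v₀ (n + 1) t‖ ≤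
        |∫ s in t₀..t, ‖v₀‖ * K ^ (n + 1) / n.factorial * |s - t₀| ^ n| := by
      rw [picardTerm]
      exact intervalIntegral.norm_integral_le_abs_of_norm_le
        (ae_restrict_of_forall_mem measurableSet_uIoc hbound) (hint _ _)
    have h2 : |∫ s in t₀..t, ‖v₀‖ * K ^ (n + 1) / n.factorial * |s - t₀| ^ n| =
        ‖v₀‖ * K ^ (n + 1) / n.factorial * (|t - t₀| ^ (n + 1) / (n + 1)) := by
      rw [intervalIntegral.integral_const_mul, abs_mul, abs_of_nonneg (by positivity)]
      congr 1
      rcases le_total t₀ t with h | h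
      · rw [abs_of_nonneg (intervalIntegral.integral_nonneg h fun s _ => by positivity),
          intervalIntegral.integral_congr (g := fun s => (s - t₀) ^ n)
          (fun s hs => by
            rw [uIcc_of_le h] at hs
            simp only [abs_of_nonneg (sub_nonneg.2 hs.1)]),
          intervalIntegral.integral_comp_sub_right (fun s => s ^ n), integral_pow,
          abs_of_nonneg (sub_nonneg.2 h)]
        simp
      · rw [intervalIntegral.integral_symm, abs_neg,
          abs_of_nonneg (intervalIntegral.integral_nonneg h fun s _ => by positivity),
          intervalIntegral.integral_congr (g := fun s => (t₀ - s) ^ n)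
          (fun s hs => by
            rw [uIcc_of_le h] at hs
            simp only [abs_of_nonpos (sub_nonpos.2 hs.2), neg_sub]),
          intervalIntegral.integral_comp_sub_left (fun s => s ^ n), integral_pow,
          abs_of_nonpos (sub_nonpos.2 h)]
        simp
    refine h1.trans (h2.trans_le (le_of_eq ?_))
    rw [Nat.factorial_succ, mul_pow]
    push_cast
    field_simp

/-- Linear differential equations with continuous coefficients have global solutions. -/
theorem exists_hasDerivAt_linear [CompleteSpace E] (hA : Continuous A) (t₀ : ℝ) (v₀ : E) :
    ∃ v : ℝ → E, v t₀ = v₀ ∧ ∀ t, HasDerivAt v (A t (v t)) t := by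
  have hbd : ∀ T : ℝ, ∃ K, 0 ≤ K ∧ ∀ t ∈ Icc (t₀ - T) (t₀ + T), ‖A t‖ ≤ K := fun T => by
    obtain ⟨K, hK⟩ := isCompact_Icc.exists_bound_of_continuousOn
      (s := Icc (t₀ - T) (t₀ + T)) hA.continuousOn
    exact ⟨max K 0, le_max_right _ _, fun t ht => (hK t ht).trans (le_max_left _ _)⟩
  have hsum0 : ∀ c : ℝ, Summable fun n : ℕ => ‖v₀‖ * c ^ n / n.factorial := fun c => by
    simpa [mul_div_assoc] using (Real.summable_pow_div_factorial c).mul_left ‖v₀‖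
  have hle : ∀ {T K : ℝ}, 0 ≤ K → (∀ t ∈ Icc (t₀ - T) (t₀ + T), ‖A t‖ ≤ K) → ∀ n : ℕ,
      ∀ t ∈ Icc (t₀ - T) (t₀ + T),
      ‖picardTerm A t₀ v₀ n t‖ ≤ ‖v₀‖ * (K * T) ^ n / n.factorial := by
    intro T K hK0 hK n t ht
    refine (norm_picardTerm_le hK hK0 v₀ n t ht).trans ?_
    have : |t - t₀| ≤ T := abs_le.2 ⟨by linarith [ht.1], by linarith [ht.2]⟩
    gcongr
  have hsum : ∀ t, Summable fun n => picardTerm A t₀ v₀ n t := fun t => by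
    obtain ⟨K, hK0, hK⟩ := hbd |t - t₀|
    refine .of_norm_bounded (hsum0 _) fun n => hle hK0 hK n t ⟨?_, ?_⟩
    · linarith [neg_abs_le (t - t₀)]
    · linarith [le_abs_self (t - t₀)]
  refine ⟨fun t => ∑' n, picardTerm A t₀ v₀ n t, ?_, fun t => ?_⟩
  · simp only
    rw [(hsum t₀).tsum_eq_zero_add]
    simp [picardTerm]
  -- The extra `1` puts `t` in the interior of the interval on which `A` is bounded.
  · obtain ⟨T, hT⟩ : ∃ T, T = |t - t₀| + 1 := ⟨_, rfl⟩
    obtain ⟨K, hK0, hK⟩ := hbd T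
    have hmem : t ∈ Ioo (t₀ - T) (t₀ + T) :=
      ⟨by linarith [neg_abs_le (t - t₀)], by linarith [le_abs_self (t - t₀)]⟩
    have hd := hasDerivAt_tsum_of_isPreconnected
      (u := fun n => K * (‖v₀‖ * (K * T) ^ n / n.factorial))
      (g := fun n => picardTerm A t₀ v₀ (n + 1)) (g' := fun n t => A t (picardTerm A t₀ v₀ n t))
      ((hsum0 _).mul_left K) isOpen_Ioo isPreconnected_Ioo
      (fun n y _ => hasDerivAt_picardTerm_succ hA t₀ v₀ n y)
      (fun n y hy => ((A y).le_opNorm _).trans (mul_le_mul (hK y (Ioo_subset_Icc_self hy))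
        (hle hK0 hK n y (Ioo_subset_Icc_self hy)) (norm_nonneg _) hK0))
      hmem ((summable_nat_add_iff 1).2 (hsum t)) hmem
    rw [← (A t).map_tsum (hsum t)] at hd
    refine (hd.const_add v₀).congr_of_eventuallyEq (.of_forall fun s => ?_)
    simp only
    rw [(hsum s).tsum_eq_zero_add]
    rfl

end LinearODE

/-- Initial value problems for `E[y] = lam y` on `(0, ∞)` are solvable. -/
theorem DiffExpr.exists_isSolution (E : DiffExpr) (lam : ℂ) {q r : ℝ → ℝ}
    (hp : ∀ x, 0 < x → E.p x = -x) (hEq : ∀ x, 0 < x → E.q x = q x)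
    (hEr : ∀ x, 0 < x → E.r x = r x) (hq : ContinuousOn q (Ioi 0)) (hr : ContinuousOn r (Ioi 0))
    {x₀ : ℝ} (hx₀ : 0 < x₀) (y₀ y₁ : ℂ) :
    ∃ y : ℝ → ℂ, E.IsSolution lam y ∧ y x₀ = y₀ ∧ deriv y x₀ = y₁ := by
  have hqe : Continuous fun t => q (Real.exp t) :=
    hq.comp_continuous Real.continuous_exp Real.exp_pos
  have hre : Continuous fun t => r (Real.exp t) :=
    hr.comp_continuous Real.continuous_exp Real.exp_pos
  let fst' : ℂ × ℂ →L[ℝ] ℂ := ContinuousLinearMap.fst ℝ ℂ ℂ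
  let snd' : ℂ × ℂ →L[ℝ] ℂ := ContinuousLinearMap.snd ℝ ℂ ℂ
  -- With `x = e^t` the half-line becomes `ℝ`, and `d/dt (y, y') = (x y', x y'')`, where `x y'' = q
  -- y' + (r - lam) y` has continuous coefficients.
  let A : ℝ → (ℂ × ℂ) →L[ℝ] (ℂ × ℂ) := fun t =>
    Real.exp t • (ContinuousLinearMap.inl ℝ ℂ ℂ).comp snd' +
    (q (Real.exp t) • (ContinuousLinearMap.inr ℝ ℂ ℂ).comp snd' +
    (r (Real.exp t) • (ContinuousLinearMap.inr ℝ ℂ ℂ).comp fst' -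
      (ContinuousLinearMap.inr ℝ ℂ ℂ).comp ((ContinuousLinearMap.mul ℝ ℂ lam).comp fst')))
  have hA : Continuous A := by
    refine .add (Real.continuous_exp.smul continuous_const) (.add (hqe.smul continuous_const)
      (.sub (hre.smul continuous_const) continuous_const))
  obtain ⟨v, hv0, hv⟩ := exists_hasDerivAt_linear hA (Real.log x₀) (y₀, y₁)
  have hd : ∀ x, 0 < x → HasDerivAt (fun x => (v (Real.log x)).1) (v (Real.log x)).2 x ∧
      HasDerivAt (fun x => (v (Real.log x)).2)
        ((q x * (v (Real.log x)).2 + (r x - lam) * (v (Real.log x)).1) / x) x := fun x hx => by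
    have h1 := (hv (Real.log x)).scomp x (Real.hasDerivAt_log hx.ne')
    have hxc : (x : ℂ) ≠ 0 := by exact_mod_cast hx.ne'
    constructor
    · have := fst'.hasFDerivAt.comp_hasDerivAt x h1
      convert! this using 1
      simp [A, fst', snd', Real.exp_log hx]
      field_simp
    · have := snd'.hasFDerivAt.comp_hasDerivAt x h1
      convert! this using 1
      simp [A, fst', snd', Real.exp_log hx]
      field_simp
  have hderiv : ∀ x, 0 < x → deriv (fun x => (v (Real.log x)).1) x = (v (Real.log x)).2 :=
    fun x hx => (hd x hx).1.deriv
  refine ⟨fun x => (v (Real.log x)).1, fun x hx => ?_, by simp [hv0], by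
    rw [hderiv x₀ hx₀, hv0]⟩
  have h2 : HasDerivAt (deriv fun x => (v (Real.log x)).1) _ x :=
    (hd x hx).2.congr_of_eventuallyEq
      (by filter_upwards [lt_mem_nhds hx] with y hy using hderiv y hy)
  have hxc : (x : ℂ) ≠ 0 := by exact_mod_cast hx.ne'
  refine ⟨(hd x hx).1.differentiableAt, h2.differentiableAt, ?_⟩
  rw [DiffExpr.apply, h2.deriv, hderiv x hx, hp x hx, hEq x hx, hEr x hx]
  push_cast
  field_simp
  ring

/-! ### Growth inside an invariant cone -/

/-- If `z' = γ z + O(ε(|z| + |w|))` and `w' = O(ε(|z| + |w|))` with `ε` small and `w = 0`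
initially, then `w` stays smaller than `z / 2` and `z` grows exponentially. -/
theorem dominant_component_growth {F : Type*} [NormedAddCommGroup F] [InnerProductSpace ℝ F]
    {z w h₁ h₂ : ℝ → F} {ε G : ℝ → ℝ} {γ s₀ : ℝ}
    (hz : ∀ s ∈ Ici s₀, HasDerivAt z (γ • z s + h₁ s) s)
    (hw : ∀ s ∈ Ici s₀, HasDerivAt w (h₂ s) s)
    (hh₁ : ∀ s ∈ Ici s₀, ‖h₁ s‖ ≤ ε s * (‖z s‖ + ‖w s‖))
    (hh₂ : ∀ s ∈ Ici s₀, ‖h₂ s‖ ≤ ε s * (‖z s‖ + ‖w s‖))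
    (hG : ∀ s ∈ Ici s₀, HasDerivAt G (ε s) s)
    (hε0 : ∀ s ∈ Ici s₀, 0 ≤ ε s) (hε : ∀ s ∈ Ici s₀, 11 * ε s ≤ 2 * γ) (hw0 : w s₀ = 0) :
    ∀ s ∈ Ici s₀, 2 * ‖w s‖ ≤ ‖z s‖ ∧
      ‖z s₀‖ ^ 2 * Real.exp (-2 * γ * s₀ + 3 * G s₀) ≤
        ‖z s‖ ^ 2 * Real.exp (-2 * γ * s + 3 * G s) := by
  have hz2 : ∀ s ∈ Ici s₀, HasDerivAt (fun s => ‖z s‖ ^ 2)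
      (2 * γ * ‖z s‖ ^ 2 + 2 * inner ℝ (z s) (h₁ s)) s := fun s hs => by
    convert! (hz s hs).norm_sq using 1
    rw [inner_add_right, real_inner_smul_right, real_inner_self_eq_norm_sq]
    ring
  have hzi : ∀ s ∈ Ici s₀, -(‖z s‖ * (ε s * (‖z s‖ + ‖w s‖))) ≤ inner ℝ (z s) (h₁ s) :=
    fun s hs => by
      have := (abs_le.1 (abs_real_inner_le_norm (z s) (h₁ s))).1
      have := mul_le_mul_of_nonneg_left (hh₁ s hs) (norm_nonneg (z s))
      linarith
  have hwi : ∀ s ∈ Ici s₀, inner ℝ (w s) (h₂ s) ≤ ‖w s‖ * (ε s * (‖z s‖ + ‖w s‖)) :=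
    fun s hs => by
      have := real_inner_le_norm (w s) (h₂ s)
      have := mul_le_mul_of_nonneg_left (hh₂ s hs) (norm_nonneg (w s))
      linarith
  have hcone : ∀ s ∈ Ici s₀, 2 * ‖w s‖ ≤ ‖z s‖ := by
    let F' : ℝ → ℝ := fun s => (‖z s‖ ^ 2 - 4 * ‖w s‖ ^ 2) * Real.exp (-4 * G s)
    have hF : ∀ s ∈ Ici s₀, HasDerivAt F' _ s := fun s hs =>
      ((hz2 s hs).sub ((hw s hs).norm_sq.const_mul 4)).mul (((hG s hs).const_mul (-4)).exp)
    have hmono : MonotoneOn F' (Ici s₀) := by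
      refine monotoneOn_of_deriv_nonneg (convex_Ici s₀)
        (fun s hs => (hF s hs).continuousAt.continuousWithinAt)
        (fun s hs => (hF s (interior_subset hs)).differentiableAt.differentiableWithinAt)
        (fun s hs => ?_)
      replace hs := interior_subset hs
      rw [(hF s hs).deriv]
      have h1 := hzi s hs
      have h2 := hwi s hs
      have h3 := hε0 s hs
      have h4 := hε s hs
      -- The perturbation costs at most `ε (6 |z|² + 10 |z||w| - 8 |w|²) ≤ 11 ε |z|²`, by `10 |z||w|
      -- ≤ 5 |z|² + 5 |w|²`; hence the constant in `hε`.
      have key : 0 ≤ 2 * γ * ‖z s‖ ^ 2 + 2 * inner ℝ (z s) (h₁ s) - 4 * (2 * inner ℝ (w s) (h₂ s))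
          - 4 * ε s * (‖z s‖ ^ 2 - 4 * ‖w s‖ ^ 2) := by
        nlinarith [mul_nonneg h3 (sq_nonneg (‖z s‖ - ‖w s‖)),
          mul_nonneg h3 (sq_nonneg (‖w s‖)), mul_nonneg (sub_nonneg.2 h4) (sq_nonneg (‖z s‖))]
      have := mul_nonneg key (Real.exp_pos (-4 * G s)).le
      simp only [Pi.sub_apply]
      linarith
    intro s hs
    have h1 := hmono self_mem_Ici hs hs
    have h2 : 0 ≤ F' s := le_trans (by simp only [F', hw0]; simp; positivity) h1
    have h3 := nonneg_of_mul_nonneg_left h2 (Real.exp_pos _)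
    exact abs_le_of_sq_le_sq' (by linarith) (norm_nonneg _) |>.2
  intro s hs
  refine ⟨hcone s hs, ?_⟩
  have hF : ∀ s ∈ Ici s₀,
      HasDerivAt (fun s => ‖z s‖ ^ 2 * Real.exp (-2 * γ * s + 3 * G s)) _ s := fun s hs =>
    (hz2 s hs).mul ((((hasDerivAt_id s).const_mul (-2 * γ)).add ((hG s hs).const_mul 3)).exp)
  refine (monotoneOn_of_deriv_nonneg (convex_Ici s₀)
    (fun s hs => (hF s hs).continuousAt.continuousWithinAt)
    (fun s hs => (hF s (interior_subset hs)).differentiableAt.differentiableWithinAt)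
    (fun s hs => ?_)) self_mem_Ici hs hs
  replace hs := interior_subset hs
  rw [(hF s hs).deriv]
  have h1 := hzi s hs
  have h2 := hcone s hs
  have h3 := hε0 s hs
  -- Inside the cone `|z| + |w| ≤ 3 |z| / 2`, so the loss is at most `3 ε |z|²`, which the factor
  -- `e^{3 G}` absorbs.
  have key : 0 ≤ 2 * inner ℝ (z s) (h₁ s) + 3 * ε s * ‖z s‖ ^ 2 := by
    nlinarith [mul_nonneg h3 (mul_nonneg (norm_nonneg (z s)) (sub_nonneg.2 h2))]
  have := mul_nonneg key (Real.exp_pos (-2 * γ * s + 3 * G s)).le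
  simp only [Pi.add_apply, id]
  linarith

/-! ### First-order systems and endpoint criteria -/

theorem DiffExpr.IsSolution.hasDerivAt {E : DiffExpr} {lam : ℂ} {y : ℝ → ℂ}
    (hy : E.IsSolution lam y) (hp : ∀ x, 0 < x → E.p x = -x) {x : ℝ} (hx : 0 < x) :
    HasDerivAt y (deriv y x) x ∧
    HasDerivAt (deriv y) ((E.q x * deriv y x + (E.r x - lam) * y x) / x) x := by
  obtain ⟨h1, h2, h3⟩ := hy x hx
  refine ⟨h1.hasDerivAt, ?_⟩
  convert! h2.hasDerivAt using 1
  have hxc : (x : ℂ) ≠ 0 := by exact_mod_cast hx.ne'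
  rw [DiffExpr.apply, hp x hx] at h3
  push_cast at h3
  rw [div_eq_iff hxc]
  linear_combination h3

/-- Near `0`, the Euler derivative `z = x y'` of a solution satisfies `x z' = -a z + x h`. -/
theorem DiffExpr.IsSolution.hasDerivAt_euler {E : DiffExpr} {lam : ℂ} {y : ℝ → ℂ} {a : ℝ}
    {g : ℝ → ℝ}
    (hy : E.IsSolution lam y) (hp : ∀ x, 0 < x → E.p x = -x)
    (hq : ∀ x, 0 < x → E.q x = x * g x - a - 1) {x : ℝ} (hx : 0 < x) :
    HasDerivAt (fun x => x * deriv y x) ((-a * (x * deriv y x)) / x +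
      (g x * (x * deriv y x) + (E.r x - lam) * y x)) x := by
  have hxc : (x : ℂ) ≠ 0 := by exact_mod_cast hx.ne'
  convert! ((hasDerivAt_id x).ofReal_comp).mul (hy.hasDerivAt hp hx).2 using 1
  rw [hq x hx]
  simp
  field_simp
  ring

theorem norm_euler_remainder_le {C g r : ℝ} {lam Z Y : ℂ} (hg : |g| ≤ C) (hr : |r| ≤ C) :
    ‖g * Z + (r - lam) * Y‖ ≤ (C + ‖lam‖) * (‖Y‖ + ‖Z‖) := by
  have h0 : 0 ≤ C := (abs_nonneg _).trans hg
  calc ‖g * Z + (r - lam) * Y‖ ≤ |g| * ‖Z‖ + ‖(r : ℂ) - lam‖ * ‖Y‖ := by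
        refine (norm_add_le _ _).trans_eq ?_
        rw [norm_mul, norm_mul, Complex.norm_real, Real.norm_eq_abs]
    _ ≤ C * ‖Z‖ + (C + ‖lam‖) * ‖Y‖ := by
        gcongr
        refine (norm_sub_le _ _).trans ?_
        rw [Complex.norm_real, Real.norm_eq_abs]
        gcongr
    _ ≤ _ := by nlinarith [norm_nonneg lam, norm_nonneg Z]

namespace DiffExpr

/-- For `N = |y|² + κ |x y'|²`, the product `x^β N` is nondecreasing near `0` once `β` slightly
exceeds `max(0, 2a) = a + |a|`. Hence `|y|² W = O(x^{a - β})`, and `|a| < 1` leaves room for `a - β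
> -1`. -/
theorem limitCircleAtZero_of_bounded {E : DiffExpr} {W : ℝ → ℝ} {a B C : ℝ} {g : ℝ → ℝ}
    (hp : ∀ x, 0 < x → E.p x = -x) (hq : ∀ x, 0 < x → E.q x = x * g x - a - 1)
    (hg : ∀ x ∈ Ioc (0 : ℝ) 1, |g x| ≤ C) (hr : ∀ x ∈ Ioc (0 : ℝ) 1, |E.r x| ≤ C)
    (hW : ∀ x ∈ Ioc (0 : ℝ) 1, |W x| ≤ B * x ^ a) (hWc : ContinuousOn W (Ioi 0))
    (ha1 : -1 < a) (ha2 : a < 1) : E.LimitCircleAtZero W := by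
  intro lam y hy
  have habs : |a| < 1 := abs_lt.2 ⟨ha1, ha2⟩
  have hC0 : 0 ≤ C := (abs_nonneg _).trans (hr 1 ⟨one_pos, le_rfl⟩)
  have hB0 : 0 ≤ B := by simpa using (abs_nonneg _).trans (hW 1 ⟨one_pos, le_rfl⟩)
  -- This `ε` gives `|a| + 2 ε < 1`. The weight `κ = 1/ε²` makes the coupling `2 |y||z|` at most `ε
  -- N`, and `c` is small enough that the remainder costs at most another `ε N`.
  obtain ⟨ε, hε⟩ : ∃ ε, ε = (1 - |a|) / 4 := ⟨_, rfl⟩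
  have hε0 : 0 < ε := by rw [hε]; linarith
  obtain ⟨κ, hκ⟩ : ∃ κ, κ = 1 / ε ^ 2 := ⟨_, rfl⟩
  have hκ0 : 0 < κ := by rw [hκ]; positivity
  have hκε : κ * ε ^ 2 = 1 := by rw [hκ]; field_simp
  obtain ⟨K, hK⟩ : ∃ K, K = (C + ‖lam‖) * (κ + 3) := ⟨_, rfl⟩
  have hK0 : 0 ≤ K := by rw [hK]; positivity
  obtain ⟨c, hc⟩ : ∃ c, c = min 1 (ε / (K + 1)) := ⟨_, rfl⟩
  have hc0 : 0 < c := by rw [hc]; positivity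
  have hc1 : c ≤ 1 := hc ▸ min_le_left _ _
  have hcK : K * c ≤ ε := by
    have h : c ≤ ε / (K + 1) := hc ▸ min_le_right _ _
    rw [le_div_iff₀ (by positivity)] at h
    linarith
  obtain ⟨β, hβ⟩ : ∃ β, β = a + |a| + 2 * ε := ⟨_, rfl⟩
  let z : ℝ → ℂ := fun x => x * deriv y x
  let N : ℝ → ℝ := fun x => ‖y x‖ ^ 2 + κ * ‖z x‖ ^ 2
  have hyd : ∀ x, 0 < x → HasDerivAt y ((1 / x) • z x) x := fun x hx => by
    convert! (hy.hasDerivAt hp hx).1 using 1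
    have hxc : (x : ℂ) ≠ 0 := by exact_mod_cast hx.ne'
    simp only [z, Complex.real_smul]
    push_cast
    field_simp
  have hzd : ∀ x, 0 < x → HasDerivAt z
      ((-a / x) • z x + (g x * z x + (E.r x - lam) * y x)) x := fun x hx => by
    convert! hy.hasDerivAt_euler hp hq hx using 2
    simp only [z, Complex.real_smul]
    push_cast
    ring
  have hN : ∀ x, 0 < x → HasDerivAt N (2 * inner ℝ (y x) ((1 / x) • z x) +
      κ * (2 * inner ℝ (z x) ((-a / x) • z x + (g x * z x + (E.r x - lam) * y x)))) x :=
    fun x hx => (hyd x hx).norm_sq.add ((hzd x hx).norm_sq.const_mul κ)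
  have hM : ∀ x, 0 < x → HasDerivAt (fun x => x ^ β * N x) _ x := fun x hx =>
    (Real.hasDerivAt_rpow_const (p := β) (Or.inl hx.ne')).mul (hN x hx)
  have hmono : MonotoneOn (fun x => x ^ β * N x) (Ioc 0 c) := by
    refine monotoneOn_of_deriv_nonneg (convex_Ioc 0 c)
      (fun x hx => (hM x hx.1).continuousAt.continuousWithinAt)
      (fun x hx => (hM x (interior_subset hx).1).differentiableAt.differentiableWithinAt)
      (fun x hx => ?_)
    obtain ⟨hx0, hxc⟩ := interior_subset hx
    rw [(hM x hx0).deriv, Real.rpow_sub_one hx0.ne', inner_add_right, real_inner_smul_right,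
      real_inner_smul_right, real_inner_self_eq_norm_sq]
    have hx1 : x ∈ Ioc (0 : ℝ) 1 := ⟨hx0, hxc.trans hc1⟩
    have hh := norm_euler_remainder_le (lam := lam) (Z := z x) (Y := y x) (hg x hx1) (hr x hx1)
    generalize (g x * z x + (E.r x - lam) * y x) = h at hh
    have h1 := (abs_le.1 (abs_real_inner_le_norm (y x) (z x))).1
    have h2 := (abs_le.1 (abs_real_inner_le_norm (z x) h)).1
    have h3 := mul_le_mul_of_nonneg_left hh (norm_nonneg (z x))
    have hD : 0 ≤ C + ‖lam‖ := by positivity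
    have hNx : N x = ‖y x‖ ^ 2 + κ * ‖z x‖ ^ 2 := rfl
    -- The losses in `e1`, `e2`, `e3` (coupling, Euler exponent, remainder) add up to `β N`.
    have e1 : -(ε * N x) ≤ 2 * inner ℝ (y x) (z x) := by
      have : ε * N x - 2 * ‖y x‖ * ‖z x‖ = ε * (‖y x‖ - κ * ε * ‖z x‖) ^ 2 +
          (κ * ε ^ 2 - 1) * (2 * ‖y x‖ * ‖z x‖ - κ * ε * ‖z x‖ ^ 2) := by rw [hNx]; ring
      rw [hκε] at this
      have h4 : 0 ≤ ε * (‖y x‖ - κ * ε * ‖z x‖) ^ 2 := by positivity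
      linarith
    have e2 : -((a + |a|) * N x) ≤ -2 * κ * a * ‖z x‖ ^ 2 := by
      have h4 : 0 ≤ (a + |a|) * ‖y x‖ ^ 2 :=
        mul_nonneg (by linarith [neg_abs_le a]) (sq_nonneg _)
      have h5 : 0 ≤ κ * (|a| - a) * ‖z x‖ ^ 2 :=
        mul_nonneg (mul_nonneg hκ0.le (by linarith [le_abs_self a])) (sq_nonneg _)
      rw [hNx]
      linarith
    have e3 : -(ε * N x) ≤ 2 * κ * x * inner ℝ (z x) h := by
      have h4 : 2 * κ * ‖z x‖ * (‖y x‖ + ‖z x‖) ≤ (κ + 3) * N x := by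
        rw [hNx]
        nlinarith [mul_nonneg hκ0.le (sq_nonneg (‖y x‖ - ‖z x‖)), sq_nonneg (‖y x‖),
          mul_nonneg (mul_nonneg hκ0.le hκ0.le) (sq_nonneg (‖z x‖))]
      have h5 : -(K * N x) ≤ 2 * κ * inner ℝ (z x) h := by
        have h6 := mul_le_mul_of_nonneg_left h4 hD
        have h7 := mul_le_mul_of_nonneg_left (show -(‖z x‖ * ((C + ‖lam‖) * (‖y x‖ + ‖z x‖))) ≤
          inner ℝ (z x) h by linarith) (show 0 ≤ 2 * κ by positivity)
        rw [hK]
        linarith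
      have hN0 : 0 ≤ N x := by rw [hNx]; positivity
      have h6 := mul_le_mul_of_nonneg_left h5 hx0.le
      have h7 := mul_le_mul_of_nonneg_right
        ((mul_le_mul_of_nonneg_left hxc hK0).trans hcK) hN0
      linarith
    have hxβ := Real.rpow_pos_of_pos hx0 β
    have key : 0 ≤ x ^ β / x * (β * N x + (2 * inner ℝ (y x) (z x) - 2 * κ * a * ‖z x‖ ^ 2 +
        2 * κ * x * inner ℝ (z x) h)) := by
      refine mul_nonneg (by positivity) ?_
      rw [hβ]
      linarith
    refine key.trans_eq ?_
    field_simp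
    ring
  refine ⟨c, hc0, ?_⟩
  have hint : IntegrableOn (fun x => (c ^ β * N c * B) * x ^ (a - β)) (Ioo 0 c) := by
    refine Integrable.const_mul ?_ _
    rw [← IntegrableOn, intervalIntegral.integrableOn_Ioo_rpow_iff hc0, hβ, hε]
    linarith
  refine Integrable.mono' hint ?_ ?_
  · refine ContinuousOn.aestronglyMeasurable (fun x hx => ?_) measurableSet_Ioo
    exact (((hyd x hx.1).continuousAt.norm.pow 2).mul
      (hWc.continuousAt (Ioi_mem_nhds hx.1))).continuousWithinAt
  · refine ae_restrict_of_forall_mem measurableSet_Ioo fun x hx => ?_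
    have h1 : x ^ β * N x ≤ c ^ β * N c := hmono ⟨hx.1, hx.2.le⟩ ⟨hc0, le_rfl⟩ hx.2.le
    have h2 : ‖y x‖ ^ 2 ≤ N x := le_add_of_nonneg_right (by positivity)
    have hxβ := Real.rpow_pos_of_pos hx.1 β
    have h3 := hW x ⟨hx.1, hx.2.le.trans hc1⟩
    have hxa := Real.rpow_pos_of_pos hx.1 a
    rw [norm_mul, norm_pow, norm_norm, Real.norm_eq_abs, Real.rpow_sub hx.1]
    calc ‖y x‖ ^ 2 * |W x| ≤ N x * (B * x ^ a) := by gcongr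
      _ = (x ^ β * N x) * B * (x ^ a / x ^ β) := by field_simp
      _ ≤ _ := by gcongr

/-- In the variable `s = -log x`, `z = x y'` grows at rate `a`, while `w = z + a y` changes only
through the remainder. A solution starting with `w = 0` keeps `|z| ≥ const · x^{-a}` and `|z| ≤ 2 a
|y|`. Then `|y|² W ≥ const · x^{-a}`, which is not integrable for `a ≥ 1`. -/
theorem limitPointAtZero_of_bounded {E : DiffExpr} {W : ℝ → ℝ} {a b C : ℝ} {g : ℝ → ℝ}
    (hp : ∀ x, 0 < x → E.p x = -x) (hq : ∀ x, 0 < x → E.q x = x * g x - a - 1)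
    (hgc : ContinuousOn g (Ioi 0)) (hrc : ContinuousOn E.r (Ioi 0))
    (hg : ∀ x ∈ Ioc (0 : ℝ) 1, |g x| ≤ C) (hr : ∀ x ∈ Ioc (0 : ℝ) 1, |E.r x| ≤ C)
    (hb : 0 < b) (hW : ∀ x ∈ Ioc (0 : ℝ) 1, b * x ^ a ≤ W x)
    (ha : 1 ≤ a) : E.LimitPointAtZero W := by
  intro lam
  have ha0 : 0 < a := by linarith
  have hC0 : 0 ≤ C := (abs_nonneg _).trans (hr 1 ⟨one_pos, le_rfl⟩)
  obtain ⟨K, hK⟩ : ∃ K, K = 2 * (C + ‖lam‖) := ⟨_, rfl⟩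
  have hK0 : 0 ≤ K := by rw [hK]; positivity
  -- Ensures `11 K x ≤ 1 ≤ 2 a` on `(0, c]`, the smallness required by the cone argument.
  obtain ⟨c, hc⟩ : ∃ c, c = 1 / (11 * K + 1) := ⟨_, rfl⟩
  have hc0 : 0 < c := by rw [hc]; positivity
  have hcK : 11 * K * c + c = 1 := by rw [hc]; field_simp
  have hc1 : c ≤ 1 := by nlinarith
  -- These data mean `z c = 1` and `w c = 0`.
  obtain ⟨y, hy, hy0, hy1⟩ := E.exists_isSolution lam hp hq (fun x _ => rfl)
    (by fun_prop) hrc hc0 (-1 / a) (1 / c)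
  refine ⟨y, hy, fun c' hc' hint => ?_⟩
  let z : ℝ → ℂ := fun x => x * deriv y x
  let w : ℝ → ℂ := fun x => z x + a * y x
  let h : ℝ → ℂ := fun x => g x * z x + (E.r x - lam) * y x
  have hac : (a : ℂ) ≠ 0 := by exact_mod_cast ha0.ne'
  have hzc : z c = 1 := by
    have hcc : (c : ℂ) ≠ 0 := by exact_mod_cast hc0.ne'
    simp only [z, hy1]; field_simp
  have hwc : w c = 0 := by
    simp only [w, hzc, hy0]; field_simp; ring
  have hzd : ∀ x, 0 < x → HasDerivAt z ((-a * z x) / x + h x) x := fun x hx =>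
    hy.hasDerivAt_euler hp hq hx
  have hwd : ∀ x, 0 < x → HasDerivAt w (h x) x := fun x hx => by
    convert! (hzd x hx).add ((hy.hasDerivAt hp hx).1.const_mul (a : ℂ)) using 1
    have hxc : (x : ℂ) ≠ 0 := by exact_mod_cast hx.ne'
    simp only [z]
    field_simp
    ring
  have hyle : ∀ x, ‖y x‖ ≤ ‖z x‖ + ‖w x‖ := fun x => by
    have h1 : a * ‖y x‖ ≤ ‖z x‖ + ‖w x‖ := by
      calc a * ‖y x‖ = ‖w x - z x‖ := by
            simp only [w, add_sub_cancel_left, norm_mul, Complex.norm_real, Real.norm_eq_abs,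
              abs_of_pos ha0]
        _ ≤ _ := (norm_sub_le _ _).trans_eq (add_comm _ _)
    nlinarith [norm_nonneg (y x)]
  have hexp : ∀ s : ℝ, HasDerivAt (fun s => Real.exp (-s)) (-Real.exp (-s)) s := fun s => by
    simpa using (hasDerivAt_neg s).exp
  have hsx : ∀ s ∈ Ici (-Real.log c), Real.exp (-s) ∈ Ioc 0 c := fun s hs =>
    ⟨Real.exp_pos _, by
      rw [← Real.le_log_iff_exp_le hc0]
      linarith [mem_Ici.1 hs]⟩
  have hh : ∀ s ∈ Ici (-Real.log c), ‖-(Real.exp (-s) : ℂ) * h (Real.exp (-s))‖ ≤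
      K * Real.exp (-s) * (‖z (Real.exp (-s))‖ + ‖w (Real.exp (-s))‖) := fun s hs => by
    have hx := hsx s hs
    have hx1 : Real.exp (-s) ∈ Ioc (0 : ℝ) 1 := ⟨hx.1, hx.2.trans hc1⟩
    have h1 := norm_euler_remainder_le (lam := lam) (Z := z (Real.exp (-s)))
      (Y := y (Real.exp (-s))) (hg _ hx1) (hr _ hx1)
    have h2 := hyle (Real.exp (-s))
    rw [norm_mul, norm_neg, Complex.norm_real, Real.norm_eq_abs, abs_of_pos (Real.exp_pos _), hK]
    have hD : 0 ≤ C + ‖lam‖ := by positivity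
    have h3 : ‖h (Real.exp (-s))‖ ≤
        2 * (C + ‖lam‖) * (‖z (Real.exp (-s))‖ + ‖w (Real.exp (-s))‖) := by
      refine h1.trans ?_
      nlinarith [norm_nonneg (w (Real.exp (-s))), mul_le_mul_of_nonneg_left h2 hD,
        mul_nonneg hD (norm_nonneg (w (Real.exp (-s))))]
    linarith [mul_le_mul_of_nonneg_left h3 (Real.exp_pos (-s)).le]
  have hgrow := dominant_component_growth (z := fun s => z (Real.exp (-s)))
    (w := fun s => w (Real.exp (-s))) (h₁ := fun s => -(Real.exp (-s) : ℂ) * h (Real.exp (-s)))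
    (h₂ := fun s => -(Real.exp (-s) : ℂ) * h (Real.exp (-s)))
    (ε := fun s => K * Real.exp (-s)) (G := fun s => -K * Real.exp (-s)) (γ := a)
    (s₀ := -Real.log c)
    (fun s hs => by
      convert! (hzd _ (Real.exp_pos (-s))).scomp s (hexp s) using 1
      have hxc : (Real.exp (-s) : ℂ) ≠ 0 := by exact_mod_cast (Real.exp_pos _).ne'
      simp only [Complex.real_smul]
      push_cast at hxc ⊢
      field_simp
      ring)
    (fun s hs => by
      convert! (hwd _ (Real.exp_pos (-s))).scomp s (hexp s) using 1
      simp)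
    hh hh
    (fun s hs => by simpa using (hexp s).const_mul (-K))
    (fun s hs => by positivity)
    (fun s hs => by
      have h1 := mul_le_mul_of_nonneg_left (hsx s hs).2 hK0
      nlinarith)
    (by simp [Real.exp_log hc0, hwc])
  obtain ⟨δ, hδ⟩ : ∃ δ, δ = Real.exp (-2 * a * -Real.log c + 3 * (-K * c)) := ⟨_, rfl⟩
  have hδ0 : 0 < δ := hδ ▸ Real.exp_pos _
  have hlow : ∀ x ∈ Ioc 0 c, δ * b / (4 * a ^ 2) * x ^ (-a) ≤ ‖y x‖ ^ 2 * W x := fun x hx => by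
    obtain ⟨h1, h2⟩ := hgrow (-Real.log x)
      (by simpa using Real.log_le_log hx.1 hx.2)
    simp only [neg_neg, Real.exp_log hx.1, Real.exp_log hc0, hzc, norm_one, one_pow, one_mul,
      ← hδ] at h1 h2
    have h3 : Real.exp (-2 * a * -Real.log x + 3 * (-K * x)) ≤ x ^ a * x ^ a := by
      rw [← Real.rpow_add hx.1, Real.rpow_def_of_pos hx.1]
      refine Real.exp_le_exp.2 ?_
      have := mul_nonneg hK0 hx.1.le
      linarith
    have h4 : δ ≤ ‖z x‖ ^ 2 * (x ^ a * x ^ a) := h2.trans (by gcongr)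
    have h5 : ‖z x‖ ≤ 2 * a * ‖y x‖ := by
      have : ‖z x‖ ≤ ‖w x‖ + a * ‖y x‖ := by
        calc ‖z x‖ = ‖w x - a * y x‖ := by simp [w]
          _ ≤ ‖w x‖ + ‖a * y x‖ := norm_sub_le _ _
          _ = _ := by
            simp only [norm_mul, Complex.norm_real, Real.norm_eq_abs, abs_of_pos ha0]
      linarith
    have hxa := Real.rpow_pos_of_pos hx.1 a
    have h6 : ‖z x‖ ^ 2 ≤ 4 * a ^ 2 * ‖y x‖ ^ 2 := by
      calc ‖z x‖ ^ 2 ≤ (2 * a * ‖y x‖) ^ 2 := by gcongr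
        _ = _ := by ring
    have h7 : δ ≤ 4 * a ^ 2 * ‖y x‖ ^ 2 * (x ^ a * x ^ a) := h4.trans (by gcongr)
    calc δ * b / (4 * a ^ 2) * x ^ (-a)
        ≤ (4 * a ^ 2 * ‖y x‖ ^ 2 * (x ^ a * x ^ a)) * b / (4 * a ^ 2) * x ^ (-a) := by
          have := Real.rpow_pos_of_pos hx.1 (-a)
          gcongr
      _ = ‖y x‖ ^ 2 * (b * x ^ a) := by rw [Real.rpow_neg hx.1.le]; field_simp
      _ ≤ _ := by
        have := hW x ⟨hx.1, hx.2.trans hc1⟩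
        gcongr
  have hc'' : 0 < min c c' := lt_min hc0 hc'
  have h1 : IntegrableOn (fun x => δ * b / (4 * a ^ 2) * x ^ (-a)) (Ioo 0 (min c c')) := by
    refine Integrable.mono' (hint.mono_set (Ioo_subset_Ioo_right (min_le_right _ _)))
      (by fun_prop) (ae_restrict_of_forall_mem measurableSet_Ioo fun x hx => ?_)
    have h0 := Real.rpow_pos_of_pos hx.1 (-a)
    rw [Real.norm_of_nonneg (by positivity)]
    exact hlow x ⟨hx.1, hx.2.le.trans (min_le_left _ _)⟩
  rw [IntegrableOn, integrable_const_mul_iff (by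
    rw [isUnit_iff_ne_zero]; positivity), ← IntegrableOn,
    intervalIntegral.integrableOn_Ioo_rpow_iff hc''] at h1
  linarith

/-- Here `z = y'` and `w = y - y'` satisfy `z' = z + h`, `w' = -h` with `h = O((|z| + |w|) / x)`.
The integral of `K / x` is logarithmic, so the perturbation costs only a power of `x`: `|y|² ≥ const
· e^{2x} x^{-3K}`, and the factor `e^{-x} x^d` cannot compensate. -/
theorem limitPointAtTop_of_bounded {E : DiffExpr} {W : ℝ → ℝ} {b d C : ℝ}
    (hp : ∀ x, 0 < x → E.p x = -x)
    (hqc : ContinuousOn E.q (Ioi 0)) (hrc : ContinuousOn E.r (Ioi 0))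
    (hq : ∀ x, 1 ≤ x → |E.q x - x| ≤ C) (hr : ∀ x, 1 ≤ x → |E.r x| ≤ C)
    (hb : 0 < b) (hW : ∀ x, 1 ≤ x → b * Real.exp (-x) * x ^ d ≤ W x) :
    E.LimitPointAtTop W := by
  intro lam
  have hC0 : 0 ≤ C := (abs_nonneg _).trans (hr 1 le_rfl)
  obtain ⟨K, hK⟩ : ∃ K, K = 2 * (C + ‖lam‖) := ⟨_, rfl⟩
  have hK0 : 0 ≤ K := by rw [hK]; positivity
  -- Gives `11 K / x ≤ 1` for `x ≥ c`, within the bound `2 γ = 2`.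
  obtain ⟨c, hc⟩ : ∃ c, c = 11 * K + 1 := ⟨_, rfl⟩
  have hc1 : 1 ≤ c := by rw [hc]; linarith
  have hc0 : 0 < c := by linarith
  obtain ⟨y, hy, hy0, hy1⟩ := E.exists_isSolution lam hp (fun x _ => rfl) (fun x _ => rfl)
    hqc hrc hc0 1 1
  refine ⟨y, hy, fun c' hc' hint => ?_⟩
  let z : ℝ → ℂ := deriv y
  let w : ℝ → ℂ := fun x => y x - z x
  let h : ℝ → ℂ := fun x => ((E.q x - x : ℝ) * z x + (E.r x - lam) * y x) / x
  have hzd : ∀ x, 0 < x → HasDerivAt z ((1 : ℝ) • z x + h x) x := fun x hx => by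
    convert! (hy.hasDerivAt hp hx).2 using 1
    have hxc : (x : ℂ) ≠ 0 := by exact_mod_cast hx.ne'
    simp only [z, h, one_smul]
    push_cast
    field_simp
    ring
  have hwd : ∀ x, 0 < x → HasDerivAt w (-h x) x := fun x hx => by
    convert! (hy.hasDerivAt hp hx).1.sub (hzd x hx) using 1
    simp [z]
  have hyle : ∀ x, ‖y x‖ ≤ ‖z x‖ + ‖w x‖ := fun x => by
    calc ‖y x‖ = ‖z x + w x‖ := by simp [w]
      _ ≤ _ := norm_add_le _ _
  have hh : ∀ x ∈ Ici c, ‖h x‖ ≤ K / x * (‖z x‖ + ‖w x‖) := fun x hx => by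
    have hx1 : 1 ≤ x := hc1.trans hx
    have hx0 : 0 < x := by linarith
    have h1 := norm_euler_remainder_le (lam := lam) (Z := z x) (Y := y x) (hq x hx1) (hr x hx1)
    simp only [h]
    rw [norm_div, Complex.norm_real, Real.norm_of_nonneg hx0.le, div_mul_eq_mul_div]
    refine div_le_div_of_nonneg_right (h1.trans ?_) hx0.le
    have hD : 0 ≤ C + ‖lam‖ := by positivity
    rw [hK]
    nlinarith [mul_le_mul_of_nonneg_left (hyle x) hD, mul_nonneg hD (norm_nonneg (w x))]
  have hpos : ∀ x ∈ Ici c, 0 < x := fun x hx => hc0.trans_le hx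
  have hgrow := dominant_component_growth (z := z) (w := w) (h₁ := h) (h₂ := fun x => -h x)
    (ε := fun x => K / x) (G := fun x => K * Real.log x) (γ := 1) (s₀ := c)
    (fun x hx => hzd x (hpos x hx)) (fun x hx => hwd x (hpos x hx)) hh
    (fun x hx => by rw [norm_neg]; exact hh x hx)
    (fun x hx => by
      simpa [div_eq_mul_inv] using (Real.hasDerivAt_log (hpos x hx).ne').const_mul K)
    (fun x hx => div_nonneg hK0 (hpos x hx).le)
    (fun x hx => by
      have h1 : K / x ≤ K / c := div_le_div_of_nonneg_left hK0 hc0 hx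
      have h2 : 11 * (K / c) ≤ 1 := by
        rw [mul_div_assoc', div_le_one hc0]; linarith
      linarith)
    (by simp [w, z, hy0, hy1])
  obtain ⟨δ, hδ⟩ : ∃ δ, δ = Real.exp (-2 * 1 * c + 3 * (K * Real.log c)) := ⟨_, rfl⟩
  have hδ0 : 0 < δ := hδ ▸ Real.exp_pos _
  have hlow : ∀ x ∈ Ici c, δ * b / 4 * (Real.exp x / x ^ (3 * K - d)) ≤ ‖y x‖ ^ 2 * W x :=
    fun x hx => by
    have hx0 := hpos x hx
    obtain ⟨h1, h2⟩ := hgrow x hx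
    have hzc : ‖z c‖ = 1 := by simp [z, hy1]
    rw [hzc, one_pow, one_mul, ← hδ] at h2
    have h5 : ‖z x‖ ≤ 2 * ‖y x‖ := by
      have : ‖z x‖ ≤ ‖y x‖ + ‖w x‖ := by
        calc ‖z x‖ = ‖y x - w x‖ := by simp [w]
          _ ≤ _ := norm_sub_le _ _
      linarith
    have h6 : ‖z x‖ ^ 2 ≤ 4 * ‖y x‖ ^ 2 := by
      calc ‖z x‖ ^ 2 ≤ (2 * ‖y x‖) ^ 2 := by gcongr
        _ = _ := by ring
    have h7 : δ ≤ 4 * ‖y x‖ ^ 2 * Real.exp (-2 * 1 * x + 3 * (K * Real.log x)) :=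
      h2.trans (by gcongr)
    have h8 : Real.exp (-2 * 1 * x + 3 * (K * Real.log x)) * (Real.exp x / x ^ (3 * K - d)) =
        Real.exp (-x) * x ^ d := by
      rw [Real.rpow_def_of_pos hx0, Real.rpow_def_of_pos hx0, ← Real.exp_sub, ← Real.exp_add,
        ← Real.exp_add]
      congr 1
      ring
    have hxd := Real.rpow_pos_of_pos hx0 (3 * K - d)
    calc δ * b / 4 * (Real.exp x / x ^ (3 * K - d))
        ≤ (4 * ‖y x‖ ^ 2 * Real.exp (-2 * 1 * x + 3 * (K * Real.log x))) * b / 4 *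
          (Real.exp x / x ^ (3 * K - d)) := by gcongr
      _ = ‖y x‖ ^ 2 * b * (Real.exp (-2 * 1 * x + 3 * (K * Real.log x)) *
          (Real.exp x / x ^ (3 * K - d))) := by ring
      _ = ‖y x‖ ^ 2 * (b * Real.exp (-x) * x ^ d) := by rw [h8]; ring
      _ ≤ _ := by
        have := hW x (hc1.trans hx)
        gcongr
  have hlim : Tendsto (fun x => δ * b / 4 * (Real.exp x / x ^ (3 * K - d))) atTop atTop :=
    (tendsto_exp_div_rpow_atTop _).const_mul_atTop (by positivity)
  obtain ⟨x₁, hx₁⟩ := eventually_atTop.1 (hlim.eventually_ge_atTop 1)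
  -- The integrand is eventually at least `1`, so its integrability would make a half-line have
  -- finite measure.
  have h1 : IntegrableOn (fun _ : ℝ => (1 : ℝ)) (Ioi (max x₁ (max c c'))) := by
    refine Integrable.mono' (hint.mono_set (Ioi_subset_Ioi
      ((le_max_right c c').trans (le_max_right _ _)))) (by fun_prop)
      (ae_restrict_of_forall_mem measurableSet_Ioi fun x hx => ?_)
    have hx' : max x₁ (max c c') ≤ x := le_of_lt hx
    rw [norm_one]
    exact (hx₁ x ((le_max_left _ _).trans hx')).trans
      (hlow x (((le_max_left _ _).trans (le_max_right _ _)).trans hx'))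
  rw [integrableOn_const_iff] at h1
  simp at h1

end DiffExpr

/-! ### Bounds for rational functions -/

namespace Polynomial

theorem degree_mul_derivative_le {P Q : ℝ[X]} (hQ : Q.degree ≤ 1) :
    (Q * derivative P).degree ≤ P.degree := by
  by_cases h : derivative P = 0
  · simp [h]
  · have hP : P.natDegree ≠ 0 := fun h0 => h (derivative_of_natDegree_zero h0)
    have h1 := natDegree_derivative_lt hP
    have hP0 : P ≠ 0 := by rintro rfl; simp at hP
    rw [degree_eq_natDegree hP0]
    refine degree_le_of_natDegree_le (natDegree_mul_le.trans ?_)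
    have := natDegree_le_of_degree_le (n := 1) hQ
    omega

/-- The degree comparison controls the quotient near infinity, compactness on the remaining
interval. -/
theorem exists_abs_div_le {P Q : ℝ[X]} (hP : ∀ x, 1 ≤ x → P.eval x ≠ 0)
    (h : Q.degree ≤ P.degree) : ∃ C, 0 < C ∧ ∀ x, 1 ≤ x → |Q.eval x / P.eval x| ≤ C := by
  obtain ⟨C₁, hC₁⟩ := (isBigO_atTop_of_degree_le Q P h).bound
  obtain ⟨x₁, hx₁⟩ := eventually_atTop.1 hC₁
  obtain ⟨C₂, hC₂⟩ := isCompact_Icc.exists_bound_of_continuousOn (s := Icc 1 x₁)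
    (f := fun x => Q.eval x / P.eval x)
    (Q.continuousOn.div P.continuousOn fun x hx => hP x hx.1)
  refine ⟨max 1 (max C₁ C₂), by positivity, fun x hx => ?_⟩
  rcases le_total x x₁ with hle | hle
  · exact (hC₂ x ⟨hx, hle⟩).trans ((le_max_right _ _).trans (le_max_right _ _))
  · refine le_trans ?_ ((le_max_left _ _).trans (le_max_right _ _))
    rw [abs_div, div_le_iff₀ (abs_pos.2 (hP x hx))]
    exact hx₁ x hle

end Polynomial

theorem exists_abs_le_Ioc {f : ℝ → ℝ} (hf : ContinuousOn f (Icc 0 1)) :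
    ∃ C, ∀ x ∈ Ioc (0 : ℝ) 1, |f x| ≤ C := by
  obtain ⟨C, hC⟩ := isCompact_Icc.exists_bound_of_continuousOn hf
  exact ⟨C, fun x hx => hC x (Ioc_subset_Icc_self hx)⟩

/-! ### The endpoint classification -/

theorem mainTheorem6 (α : ℝ) (M₁ M₂ : MayaDiagram) (hM : Admissible α M₁ M₂) :
    (∀ lam : ℂ, (xopExpr α M₁ M₂).HasIndicialPolynomialAtZero lam
      (fun s => s * (s + (xopParam α M₁ M₂ : ℂ)))) ∧
    (-1 < xopParam α M₁ M₂ → xopParam α M₁ M₂ < 1 →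
      (xopExpr α M₁ M₂).LimitCircleAtZero (xopWeight α M₁ M₂)) ∧
    (1 ≤ xopParam α M₁ M₂ →
      (xopExpr α M₁ M₂).LimitPointAtZero (xopWeight α M₁ M₂)) ∧
    (0 < xopParam α M₁ M₂ →
      (xopExpr α M₁ M₂).LimitPointAtTop (xopWeight α M₁ M₂)) := by
  obtain ⟨P, hP, hG, hWr⟩ := hM.exists_polynomial
  have hcoeff := fun x hx => xopExpr_coeff hP hG hWr (x := x) hx
  have hW : ∀ x, 0 < x → xopWeight α M₁ M₂ x =
      x ^ xopParam α M₁ M₂ * (Real.exp (-x) / P.eval x ^ 2) := fun x hx => by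
    rw [xopWeight, hG x hx, mul_div_assoc]
  generalize xopWeight α M₁ M₂ = W at hW ⊢
  generalize xopExpr α M₁ M₂ = E at hcoeff ⊢
  generalize xopParam α M₁ M₂ = a at hcoeff hW ⊢
  obtain ⟨κ, hκ⟩ : ∃ κ : ℝ, κ = M₁.right.length - M₁.left.length := ⟨_, rfl⟩
  let g : ℝ → ℝ := fun x => 1 + 2 * (P.derivative.eval x / P.eval x)
  let r : ℝ → ℝ := fun x => κ - (x - a) * (P.derivative.eval x / P.eval x) -
    x * P.derivative.derivative.eval x / P.eval x
  have hp : ∀ x, 0 < x → E.p x = -x := fun x hx => (hcoeff x hx).1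
  have hq : ∀ x, 0 < x → E.q x = x * g x - a - 1 := fun x hx => by
    rw [(hcoeff x hx).2.1]; ring
  have hr : ∀ x, 0 < x → E.r x = r x := fun x hx => by
    rw [(hcoeff x hx).2.2, ← hκ]
  have hPc : ∀ Q : Polynomial ℝ, ContinuousOn (fun x => Q.eval x) (Ici 0) := fun Q => Q.continuousOn
  have hgc : ContinuousOn g (Ici 0) :=
    continuousOn_const.add (continuousOn_const.mul ((hPc _).div (hPc _) hP))
  have hrc : ContinuousOn r (Ici 0) :=
    (continuousOn_const.sub ((continuousOn_id.sub continuousOn_const).mul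
      ((hPc _).div (hPc _) hP))).sub ((continuousOn_id.mul (hPc _)).div (hPc _) hP)
  have hωc : ContinuousOn (fun x => Real.exp (-x) / P.eval x ^ 2) (Ici 0) :=
    ContinuousOn.div (by fun_prop) ((hPc _).pow 2) fun x hx => pow_ne_zero 2 (hP x hx)
  have hsub : Icc (0 : ℝ) 1 ⊆ Ici 0 := Icc_subset_Ici_self
  have hErc : ContinuousOn E.r (Ioi 0) :=
    (hrc.mono Ioi_subset_Ici_self).congr fun x hx => hr x hx
  obtain ⟨C₁, hC₁⟩ := exists_abs_le_Ioc (hgc.mono hsub)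
  obtain ⟨C₂, hC₂⟩ := exists_abs_le_Ioc (hrc.mono hsub)
  have hg' : ∀ x ∈ Ioc (0 : ℝ) 1, |g x| ≤ max C₁ C₂ := fun x hx =>
    (hC₁ x hx).trans (le_max_left _ _)
  have hr' : ∀ x ∈ Ioc (0 : ℝ) 1, |E.r x| ≤ max C₁ C₂ := fun x hx =>
    hr x hx.1 ▸ (hC₂ x hx).trans (le_max_right _ _)
  refine ⟨fun lam => ?_, fun h1 h2 => ?_, fun h1 => ?_, fun _ => ?_⟩
  · have hPa : ∀ Q : Polynomial ℝ, AnalyticAt ℝ (fun x => Q.eval x) 0 := fun Q => by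
      simpa using (analyticAt_id (𝕜 := ℝ) (z := (0 : ℝ))).aeval_polynomial Q
    have hP0 := hP 0 le_rfl
    have hga : AnalyticAt ℝ g 0 :=
      analyticAt_const.add (analyticAt_const.mul ((hPa _).div (hPa _) hP0))
    have hra : AnalyticAt ℝ r 0 :=
      (analyticAt_const.sub ((analyticAt_id.sub analyticAt_const).mul
        ((hPa _).div (hPa _) hP0))).sub ((analyticAt_id.mul (hPa _)).div (hPa _) hP0)
    -- Division by `-x` gives `b(0) = a + 1` and `c(0) = 0`, so the indicial polynomial is `s (s -
    -- 1) + (a + 1) s`.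
    refine ⟨fun x => -(x * g x - a - 1), fun x => -(x : ℂ) * ((r x : ℂ) - lam), ?_, ?_, ?_, ?_⟩
    · exact (((analyticAt_id.mul hga).sub analyticAt_const).sub analyticAt_const).neg
    · exact (Complex.ofRealCLM.analyticAt 0).neg.mul
        (((Complex.ofRealCLM.analyticAt _).comp hra).sub analyticAt_const)
    · filter_upwards [self_mem_nhdsWithin] with x hx
      have hx0 : x ≠ 0 := ne_of_gt hx
      have hxc : (x : ℂ) ≠ 0 := by exact_mod_cast hx0
      rw [hp x hx, hq x hx, hr x hx]
      refine ⟨neg_ne_zero.2 hx0, by field_simp, ?_⟩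
      push_cast
      field_simp
    · intro s
      push_cast
      ring
  · obtain ⟨B, hB⟩ := exists_abs_le_Ioc (hωc.mono hsub)
    refine E.limitCircleAtZero_of_bounded (B := B) hp hq hg' hr' (fun x hx => ?_) ?_ h1 h2
    · have hxa := Real.rpow_pos_of_pos hx.1 a
      rw [hW x hx.1, abs_mul, abs_of_pos hxa, mul_comm]
      exact mul_le_mul_of_nonneg_right (hB x hx) hxa.le
    · refine ContinuousOn.congr (ContinuousOn.mul (fun x hx => ?_)
        (hωc.mono Ioi_subset_Ici_self)) fun x hx => hW x hx
      exact (Real.continuousAt_rpow_const x a (Or.inl (ne_of_gt hx))).continuousWithinAt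
  · obtain ⟨x₀, hx₀, hmin⟩ := isCompact_Icc.exists_isMinOn (nonempty_Icc.2 zero_le_one)
      (hωc.mono hsub)
    have hb : 0 < Real.exp (-x₀) / P.eval x₀ ^ 2 :=
      div_pos (Real.exp_pos _) (sq_pos_of_ne_zero (hP x₀ hx₀.1))
    refine E.limitPointAtZero_of_bounded hp hq (hgc.mono Ioi_subset_Ici_self) hErc hg' hr' hb
      (fun x hx => ?_) h1
    rw [hW x hx.1, mul_comm]
    exact mul_le_mul_of_nonneg_left (hmin (Ioc_subset_Icc_self hx))
      (Real.rpow_pos_of_pos hx.1 a).le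
  · have hP1 : ∀ x, 1 ≤ x → P.eval x ≠ 0 := fun x hx => hP x (by linarith)
    obtain ⟨B₁, hB₁0, hB₁⟩ := Polynomial.exists_abs_div_le (Q := Polynomial.X * P.derivative) hP1
      (Polynomial.degree_mul_derivative_le Polynomial.degree_X_le)
    obtain ⟨B₂, hB₂0, hB₂⟩ := Polynomial.exists_abs_div_le (Q := (Polynomial.X - Polynomial.C a) * P.derivative) hP1
      (Polynomial.degree_mul_derivative_le (Polynomial.degree_X_sub_C_le a))
    obtain ⟨B₃, hB₃0, hB₃⟩ := Polynomial.exists_abs_div_le (Q := Polynomial.X * P.derivative.derivative) hP1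
      ((Polynomial.degree_mul_derivative_le Polynomial.degree_X_le).trans Polynomial.degree_derivative_le)
    -- The bound `|P| ≤ B x^{deg P}` on `[1, ∞)` turns `1 / P²` into a lower bound for the weight,
    -- whence `d = a - 2 deg P`.
    obtain ⟨B, hB0, hB⟩ := Polynomial.exists_abs_div_le (P := Polynomial.X ^ P.natDegree) (Q := P)
      (fun x hx => by simp only [Polynomial.eval_pow, Polynomial.eval_X]; positivity)
      (by rw [Polynomial.degree_X_pow]; exact Polynomial.degree_le_natDegree)
    simp only [Polynomial.eval_mul, Polynomial.eval_X, Polynomial.eval_sub, Polynomial.eval_C, Polynomial.eval_pow] at hB₁ hB₂ hB₃ hB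
    refine E.limitPointAtTop_of_bounded (b := 1 / B ^ 2) (d := a - 2 * P.natDegree)
      (C := |a| + 1 + 2 * B₁ + |κ| + B₂ + B₃) hp ?_ hErc (fun x hx => ?_) (fun x hx => ?_)
      (by positivity) (fun x hx => ?_)
    · refine ContinuousOn.congr (((continuousOn_id.mul (hgc.mono Ioi_subset_Ici_self)).sub
        continuousOn_const).sub continuousOn_const) fun x hx => hq x hx
    · have h1 := abs_le.1 (hB₁ x hx)
      have h2 : E.q x - x = 2 * (x * P.derivative.eval x / P.eval x) - a - 1 := by
        rw [hq x (by linarith)]; ring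
      have := abs_nonneg κ
      rw [h2, abs_le]
      constructor <;> linarith [neg_abs_le a, le_abs_self a]
    · have h1 := abs_le.1 (hB₂ x hx)
      have h2 := abs_le.1 (hB₃ x hx)
      have := abs_nonneg a
      rw [hr x (by linarith), abs_le]
      simp only [r]
      rw [mul_div_assoc] at h1
      constructor <;> linarith [neg_abs_le κ, le_abs_self κ]
    · have hx0 : 0 < x := by linarith
      have h1 := hB x hx
      rw [abs_div, abs_of_pos (by positivity : 0 < x ^ P.natDegree),
        div_le_iff₀ (by positivity)] at h1
      have h2 : P.eval x ^ 2 ≤ B ^ 2 * (x ^ P.natDegree) ^ 2 := by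
        rw [← mul_pow, ← sq_abs]
        gcongr
      have h3 : 0 < P.eval x ^ 2 := sq_pos_of_ne_zero (hP1 x hx)
      have h4 : x ^ (a - 2 * P.natDegree) = x ^ a / (x ^ P.natDegree) ^ 2 := by
        rw [Real.rpow_sub hx0, ← pow_mul, mul_comm P.natDegree, ← Real.rpow_natCast]
        push_cast
        rfl
      have hxa := Real.rpow_pos_of_pos hx0 a
      rw [hW x hx0, h4]
      calc 1 / B ^ 2 * Real.exp (-x) * (x ^ a / (x ^ P.natDegree) ^ 2)
          = x ^ a * (Real.exp (-x) / (B ^ 2 * (x ^ P.natDegree) ^ 2)) := by field_simp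
        _ ≤ _ := by gcongr
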